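/- Let $n\ge 1$, $s\in(0,1)$, let $c_{n,s}>0$ be a (normalizing) constant, $I\subset\mathbb{R}$ an interval (not necessarily open or bounded), $\Omega\subset\mathbb{R}^n$ a bounded domain, $\Omega^c=\mathbb{R}^n\setminus\Omega$, $Q(\Omega)=(\mathbb{R}^n\times\mathbb{R}^n)\setminus(\Omega^c\times\Omega^c)$, and $F\in C^1(\mathbb{R})$. Let $\{u^t\}_{t\in I}$ be a $C^2$ field in $\mathbb{R}^n$, that is, a family of functions $u^t:\mathbb{R}^n\to\mathbb{R}$ such that $(x,t)\mapsto u^t(x)$ is of class $C^2$ in $\mathbb{R}^n\times I$ and, for each $x$, $t\mapsto u^t(x)$ is $C^1$ and strictly increasing in $I$. Assume that for some constant $C$ $$|u^t(x)|+|\partial_t u^t(x)|\le C\qquad\text{for all }x\in\mathbb{R}^n,\ t\in I .$$ Let $\mathcal G=\{(x,\lambda)\in\mathbb{R}^n\times\mathbb{R}:\lambda=u^t(x)\text{ for some }t\in I\}$, let $t(x,\lambda)\in I$ be determined for $(x,\lambda)\in\mathcal G$ by $u^{t(x,\lambda)}(x)=\lambda$, and let $$\mathcal A_s=\{w\in C^0(\mathbb{R}^n)\cap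 L^\infty(\mathbb{R}^n): \operatorname{graph} w\subset\mathcal G\}.$$ For $w\in\mathcal A_s$ put $$\mathcal E_{s,F}(w)=\frac{c_{n,s}}4\iint_{Q(\Omega)}\frac{|w(x)-w(y)|^2}{|x-y|^{n+2s}}\,dx\,dy-\int_\Omega F(w(x))\,dx\in(-\infty,+\infty],$$ $$(-\Delta)^s w(x)=c_{n,s}\lim_{\varepsilon\downarrow0}\int_{\{|x-y|\ge\varepsilon\}}\frac{w(x)-w(y)}{|x-y|^{n+2s}}\,dy$$ (whenever this limit exists). Fix $t_0\in I$ and, for $w\in\mathcal A_s$ with $w=u^{t_0}$ in $\Omega^c$, put $$\begin{aligned}\mathcal C_{s,F}(w)={}&c_{n,s}\lim_{\varepsilon\downarrow0}\iint_{Q(\Omega)\cap\{|x-y|\ge\varepsilon\}}\int_{u^{t_0}(x)}^{w(x)}\frac{u^t(x)-u^t(y)}{|x-y|^{n+2s}}\Big|_{t=t(x,\lambda)}d\lambda\,dx\,dy-\int_\Omega F(w(x))\,dx\\&+\frac{c_{n,s}}4\iint_{Q(\Omega)}\frac{|u^{t_0}(x)-u^{t_0}(y)|^2}{|x-y|^{n+2s}}\,dx\,dy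 .\end{aligned}$$ Then $(-\Delta)^su^t(x)$ exists for all $t\in I$ and $x\in\mathbb{R}^n$, $\mathcal C_{s,F}(w)$ is well defined for all such $w$ (the integrals converge and the limit exists and is finite), and the following hold. (a) $u^{t_0}\in\mathcal A_s$; $\mathcal C_{s,F}(u^{t_0})=\mathcal E_{s,F}(u^{t_0})$; and $\mathcal C_{s,F}(w)\le\mathcal E_{s,F}(w)$ for all $w\in\mathcal A_s$ with $w=u^{t_0}$ in $\Omega^c$. (b) Assume in addition that, in $\Omega$, $(-\Delta)^su^t-F'(u^t)\ge0$ for all $t\in I$ with $t\ge t_0$, and $(-\Delta)^su^t-F'(u^t)\le0$ for all $t\in I$ with $t\le t_0$. Then $\mathcal C_{s,F}(u^{t_0})\le\mathcal C_{s,F}(w)$ for all $w\in\mathcal A_s$ with $w=u^{t_0}$ in $\Omega^c$. In particular, $u^{t_0}$ minimizes $\mathcal E_{s,F}$ among functions $w\in\mathcal A_s$ with $w=u^{t_0}$ in $\Omega^c$. (c) Assume in addition that $(-\Delta)^su^t-F'(u^t)=0$ in $\Omega$ for all $t\in I$. Then $\mathcal C_{s,F}(w)=\mathcal C_{s,F}(\widetilde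 w)$ for all $w,\widetilde w\in\mathcal A_s$ with $w=\widetilde w=u^{t_0}$ in $\Omega^c$ (null-Lagrangian property). Therefore $\mathcal C_{s,F}$ is a calibration for $\mathcal E_{s,F}$ and $u^{t_0}$, that is, it has this property and those in (a). As a consequence, for every $t\in I$, $u^t$ minimizes $\mathcal E_{s,F}$ among functions $w\in\mathcal A_s$ with $w=u^t$ in $\Omega^c$. -/

import Mathlib

open Set Filter Topology MeasureTheory
open scoped ENNReal

noncomputable section

namespace FracCalib

/-- Euclidean space `ℝⁿ`. -/
abbrev Rn (n : ℕ) : Type := EuclideanSpace ℝ (Fin n)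

variable {n : ℕ}

/-! ### Calibrations -/

/-- `w` and `u` satisfy the same (nonlocal) Dirichlet condition: they agree in `ℝⁿ \ Ω`. -/
def SameDirichlet (Ω : Set (Rn n)) (w u : Rn n → ℝ) : Prop :=
  ∀ x ∈ Ωᶜ, w x = u x

/-- (C1): `C(u) = E(u)`. Energies may take the value `+∞`. -/
def CalibC1 (C : (Rn n → ℝ) → ℝ) (E : (Rn n → ℝ) → EReal) (u : Rn n → ℝ) : Prop :=
  (C u : EReal) = E u

/-- (C2): `C(w) ≤ E(w)` for all admissible `w` with the same Dirichlet condition as `u`. -/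
def CalibC2 (Ω : Set (Rn n)) (A : Set (Rn n → ℝ)) (C : (Rn n → ℝ) → ℝ)
    (E : (Rn n → ℝ) → EReal) (u : Rn n → ℝ) : Prop :=
  ∀ w ∈ A, SameDirichlet Ω w u → (C w : EReal) ≤ E w

/-- (C3), the null-Lagrangian property: `C` is constant on the admissible functions with the
same Dirichlet condition as `u`. -/
def CalibC3 (Ω : Set (Rn n)) (A : Set (Rn n → ℝ)) (C : (Rn n → ℝ) → ℝ)
    (u : Rn n → ℝ) : Prop :=
  ∀ w ∈ A, ∀ w' ∈ A, SameDirichlet Ω w u → SameDirichlet Ω w' u → C w = C w'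

/-- (C3'): `C(u) ≤ C(w)` for all admissible `w` with the same Dirichlet condition as `u`. -/
def CalibC3' (Ω : Set (Rn n)) (A : Set (Rn n → ℝ)) (C : (Rn n → ℝ) → ℝ)
    (u : Rn n → ℝ) : Prop :=
  ∀ w ∈ A, SameDirichlet Ω w u → C u ≤ C w

/-- `C` is a calibration for the energy `E` and the admissible function `u`. -/
structure IsCalibration (Ω : Set (Rn n)) (A : Set (Rn n → ℝ)) (C : (Rn n → ℝ) → ℝ)
    (E : (Rn n → ℝ) → EReal) (u : Rn n → ℝ) : Prop where
  mem : u ∈ A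
  c1 : CalibC1 C E u
  c2 : CalibC2 Ω A C E u
  c3 : CalibC3 Ω A C u

/-- `u` is admissible and minimizes `E` among the admissible functions equal to `u`
in `ℝⁿ \ Ω`. -/
def IsMinimizer (Ω : Set (Rn n)) (A : Set (Rn n → ℝ)) (E : (Rn n → ℝ) → EReal)
    (u : Rn n → ℝ) : Prop :=
  u ∈ A ∧ ∀ w ∈ A, SameDirichlet Ω w u → E u ≤ E w

/-! ### Fields and the leaf-parameter function -/

/-- `{u t}`, `t ∈ I`, is a field in the whole space `ℝⁿ`. -/
structure IsField (I : Set ℝ) (u : ℝ → Rn n → ℝ) : Prop where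
  continuousOn : ContinuousOn (fun p : Rn n × ℝ => u p.2 p.1) (univ ×ˢ I)
  contDiffOn_param : ∀ x, ContDiffOn ℝ 1 (fun t => u t x) I
  strictMonoOn_param : ∀ x, StrictMonoOn (fun t => u t x) I

/-- `{u t}`, `t ∈ I`, is a `C²` field in `ℝⁿ`: moreover `(x, t) ↦ u t x` is `C²` in `ℝⁿ × I`. -/
structure IsC2Field (I : Set ℝ) (u : ℝ → Rn n → ℝ) : Prop extends IsField I u where
  contDiffOn : ContDiffOn ℝ 2 (fun p : Rn n × ℝ => u p.2 p.1) (univ ×ˢ I)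

/-- The region `G ⊆ ℝⁿ × ℝ` foliated by the graphs of the leaves. -/
def foliatedRegion (I : Set ℝ) (u : ℝ → Rn n → ℝ) : Set (Rn n × ℝ) :=
  {p | ∃ t ∈ I, p.2 = u t p.1}

/-- The leaf-parameter function `t(x, l)`, determined on the foliated region by
`t(x, l) ∈ I` and `u (t(x, l)) x = l` (arbitrary elsewhere). -/
def leafParam (I : Set ℝ) (u : ℝ → Rn n → ℝ) (x : Rn n) (l : ℝ) : ℝ :=
  Function.invFunOn (fun t => u t x) I l

theorem leafParam_spec {I : Set ℝ} {u : ℝ → Rn n → ℝ} {x : Rn n} {l : ℝ}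
    (h : (x, l) ∈ foliatedRegion I u) :
    leafParam I u x l ∈ I ∧ u (leafParam I u x l) x = l := by
  have h' : ∃ t ∈ I, (fun t => u t x) t = l := by
    obtain ⟨t, ht, hl⟩ := h
    exact ⟨t, ht, hl.symm⟩
  exact ⟨Function.invFunOn_mem h', Function.invFunOn_eq h'⟩

theorem leafParam_unique {I : Set ℝ} {u : ℝ → Rn n → ℝ} (hu : IsField I u) {x : Rn n}
    {t : ℝ} (ht : t ∈ I) : leafParam I u x (u t x) = t := by
  have h := leafParam_spec (I := I) (u := u) (x := x) (l := u t x) ⟨t, ht, rfl⟩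
  exact (hu.strictMonoOn_param x).injOn h.1 ht h.2

/-- The admissible functions: continuous, bounded, with graph in the foliated region. -/
def admissible (I : Set ℝ) (u : ℝ → Rn n → ℝ) : Set (Rn n → ℝ) :=
  {w | Continuous w ∧ (∃ M : ℝ, ∀ x, |w x| ≤ M) ∧ ∀ x, (x, w x) ∈ foliatedRegion I u}

/-! ### The fractional energy, the fractional Laplacian and the functional `C_{s,F}` -/

/-- `Q(Ω) = (ℝⁿ × ℝⁿ) \ (Ωᶜ × Ωᶜ)`. -/
def QSet (Ω : Set (Rn n)) : Set (Rn n × Rn n) := (Ωᶜ ×ˢ Ωᶜ)ᶜ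

/-- `(c/4) ∬_{Q(Ω)} |w(x) - w(y)|² / |x - y|^{n+2s} dx dy`, as a number in `[0, ∞]`. -/
def seminormEnergy (c s : ℝ) (Ω : Set (Rn n)) (w : Rn n → ℝ) : ℝ≥0∞ :=
  ENNReal.ofReal (c / 4) *
    ∫⁻ p in QSet Ω, ENNReal.ofReal (|w p.1 - w p.2| ^ 2 / ‖p.1 - p.2‖ ^ ((n : ℝ) + 2 * s))

/-- The energy `E_{s,F}(w)`, with values in `(-∞, ∞]`. -/
def energy (c s : ℝ) (Ω : Set (Rn n)) (F : ℝ → ℝ) (w : Rn n → ℝ) : EReal :=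
  (seminormEnergy c s Ω w : EReal) - ((∫ x in Ω, F (w x) : ℝ) : EReal)

/-- The truncated operator `c ∫_{|x - y| ≥ ε} (v(x) - v(y)) / |x - y|^{n+2s} dy`. -/
def fracLaplacianTrunc (c s ε : ℝ) (v : Rn n → ℝ) (x : Rn n) : ℝ :=
  c * ∫ y in {y | ε ≤ ‖x - y‖}, (v x - v y) / ‖x - y‖ ^ ((n : ℝ) + 2 * s)

/-- The fractional Laplacian `(-Δ)^s v (x)`, as a principal value. -/
def fracLaplacian (c s : ℝ) (v : Rn n → ℝ) (x : Rn n) : ℝ :=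
  limUnder (𝓝[>] (0 : ℝ)) (fun ε => fracLaplacianTrunc c s ε v x)

/-- `(u^t(x) - u^t(y)) / |x - y|^{n+2s}` at `t = t(x, l)`. -/
def leafQuotient (s : ℝ) (I : Set ℝ) (u : ℝ → Rn n → ℝ) (x y : Rn n) (l : ℝ) : ℝ :=
  (u (leafParam I u x l) x - u (leafParam I u x l) y) / ‖x - y‖ ^ ((n : ℝ) + 2 * s)

/-- `∫_{u^{t₀}(x)}^{w(x)} (u^t(x) - u^t(y)) / |x - y|^{n+2s} |_{t = t(x, l)} dl`,
as a function of `p = (x, y)`. -/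
def pvDensity (s : ℝ) (I : Set ℝ) (u : ℝ → Rn n → ℝ) (t₀ : ℝ) (w : Rn n → ℝ)
    (p : Rn n × Rn n) : ℝ :=
  ∫ l in (u t₀ p.1)..(w p.1), leafQuotient s I u p.1 p.2 l

/-- `∬` of the density over `Q(Ω)` with the strip `|x - y| < ε` removed. -/
def pvTrunc (s : ℝ) (Ω : Set (Rn n)) (I : Set ℝ) (u : ℝ → Rn n → ℝ) (t₀ : ℝ)
    (w : Rn n → ℝ) (ε : ℝ) : ℝ :=
  ∫ p in QSet Ω ∩ {p | ε ≤ ‖p.1 - p.2‖}, pvDensity s I u t₀ w p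

/-- The principal value `lim_{ε ↓ 0}` of the truncated double integrals. -/
def pvIntegral (s : ℝ) (Ω : Set (Rn n)) (I : Set ℝ) (u : ℝ → Rn n → ℝ) (t₀ : ℝ)
    (w : Rn n → ℝ) : ℝ :=
  limUnder (𝓝[>] (0 : ℝ)) (fun ε => pvTrunc s Ω I u t₀ w ε)

/-- The functional `C_{s,F}`. -/
def calibration (c s : ℝ) (Ω : Set (Rn n)) (I : Set ℝ) (u : ℝ → Rn n → ℝ) (t₀ : ℝ)
    (F : ℝ → ℝ) (w : Rn n → ℝ) : ℝ :=
  c * pvIntegral s Ω I u t₀ w - (∫ x in Ω, F (w x)) + (seminormEnergy c s Ω (u t₀)).toReal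

/-- All integrals in `C_{s,F}(w)` converge, and its principal value exists as a limit. -/
structure WellDefinedAt (c s : ℝ) (Ω : Set (Rn n)) (I : Set ℝ) (u : ℝ → Rn n → ℝ) (t₀ : ℝ)
    (F : ℝ → ℝ) (w : Rn n → ℝ) : Prop where
  inner : ∀ x y, IntervalIntegrable (leafQuotient s I u x y) volume (u t₀ x) (w x)
  outer : ∀ ε > 0,
    IntegrableOn (pvDensity s I u t₀ w) (QSet Ω ∩ {p | ε ≤ ‖p.1 - p.2‖})
  limit : Tendsto (pvTrunc s Ω I u t₀ w) (𝓝[>] 0) (𝓝 (pvIntegral s Ω I u t₀ w))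
  potential : IntegrableOn (fun x => F (w x)) Ω
  leaf : seminormEnergy c s Ω (u t₀) ≠ ∞

end FracCalib

end

open FracCalib

namespace FracCalib

noncomputable section

variable {n : ℕ} {I : Set ℝ} {u : ℝ → Rn n → ℝ} {t₀ : ℝ} {w : Rn n → ℝ}

/-! Write (-Δ)^s for the fractional Laplacian. The functional C has two descriptions, and each gives
half of the calibration property.

First, move from `u t₀ x` to `w x` linearly in θ ∈ [0, 1] and follow the leaf met at each height
(`leafTime`). Away from the diagonal Fubini applies, and since `w` agrees with `u t₀` outside Ω only
x ∈ Ω contributes. The truncated double integral becomes an integral over Ω × (0, 1) of w - u^{t₀}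
times truncated fractional Laplacians of leaves. On compact sets the leaves have uniformly quadratic
second differences, which dominates the truncations, so the limit exists (`tendsto_pvTrunc`). Adding
the same representation of the potential gives `calibration_eq`: C(w) - C(u^{t₀}) is the integral of
(w - u^{t₀})((-Δ)^s u^t - F'(u^t)) over the leaves crossed. For exact solutions it vanishes. Under
the one-sided conditions both factors have the same sign, since heights above u^{t₀} lie on leaves t
≥ t₀.

Second, symmetrize in (x, y). If both points move to the same leaf, the sum of the two densities is
exactly half the increment of |u^t(x) - u^t(y)|² over the kernel. If one point goes further,
monotonicity of the leaves leaves only an inequality (`integral_sub_leafParam_add_le`). Integrating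
over Q(Ω) and letting ε ↓ 0 yields C ≤ E (`calibC2_leaf`).

Minimality is then the chain E(u) = C(u) ≤ C(w) ≤ E(w). -/

/-! ### Integrability of the fractional kernel. -/

theorem integrable_min_sq_div_norm_rpow (hn : 1 ≤ n) {s : ℝ} (hs : s ∈ Ioo (0 : ℝ) 1) {K A : ℝ}
    (hK : 0 ≤ K) (hA : 0 ≤ A) :
    Integrable (fun z : Rn n => min (K * ‖z‖ ^ 2) A / ‖z‖ ^ ((n : ℝ) + 2 * s)) := by
  have : Nonempty (Fin n) := ⟨⟨0, hn⟩⟩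
  have key := integrable_fun_norm_addHaar (E := Rn n) (volume : Measure (Rn n))
    (f := fun r : ℝ => min (K * r ^ 2) A / r ^ ((n : ℝ) + 2 * s))
  rw [key]
  have hmeas : Measurable fun y : ℝ => y ^ (Module.finrank ℝ (Rn n) - 1) •
      (min (K * y ^ 2) A / y ^ ((n : ℝ) + 2 * s)) := by fun_prop
  -- In polar coordinates the weight is r^{-1-2s}. The quadratic bound turns it into r^{1-2s} near
  -- 0, integrable because s < 1; the constant bound suffices at infinity because s > 0.
  have hpow : ∀ y : ℝ, 0 < y → y ^ (n - 1) / y ^ ((n : ℝ) + 2 * s) = y ^ (-1 - 2 * s) := by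
    intro y hy
    rw [← Real.rpow_natCast y (n - 1), ← Real.rpow_sub hy, Nat.cast_sub hn]
    congr 1
    push_cast
    ring
  rw [← Ioc_union_Ioi_eq_Ioi zero_le_one]
  refine IntegrableOn.union ?_ ?_
  · have h1 : IntegrableOn (fun y : ℝ => K * y ^ (1 - 2 * s)) (Ioc 0 1) :=
      ((intervalIntegrable_iff_integrableOn_Ioc_of_le zero_le_one).1
        (intervalIntegral.intervalIntegrable_rpow' (by linarith [hs.2]))).const_mul K
    refine Integrable.mono' h1 hmeas.aestronglyMeasurable
      ((ae_restrict_iff' measurableSet_Ioc).2 (Eventually.of_forall fun y hy => ?_))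
    have hy0 := hy.1
    have e1 : y ^ (1 - 2 * s) = y ^ 2 * (y ^ (n - 1) / y ^ ((n : ℝ) + 2 * s)) := by
      rw [hpow y hy0, ← Real.rpow_natCast y 2, ← Real.rpow_add hy0]
      congr 1
      push_cast
      ring
    rw [e1, finrank_euclideanSpace_fin, Real.norm_of_nonneg (by positivity), smul_eq_mul]
    calc y ^ (n - 1) * (min (K * y ^ 2) A / y ^ ((n : ℝ) + 2 * s))
        = min (K * y ^ 2) A * (y ^ (n - 1) / y ^ ((n : ℝ) + 2 * s)) := by ring
      _ ≤ (K * y ^ 2) * (y ^ (n - 1) / y ^ ((n : ℝ) + 2 * s)) := by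
          gcongr
          exact min_le_left _ _
      _ = _ := by ring
  · have h1 : IntegrableOn (fun y : ℝ => A * y ^ (-1 - 2 * s)) (Ioi 1) :=
      (integrableOn_Ioi_rpow_of_lt (by linarith [hs.1]) one_pos).const_mul A
    refine Integrable.mono' h1 hmeas.aestronglyMeasurable
      ((ae_restrict_iff' measurableSet_Ioi).2 (Eventually.of_forall fun y hy => ?_))
    have hy0 : 0 < y := lt_trans one_pos hy
    rw [← hpow y hy0, finrank_euclideanSpace_fin, Real.norm_of_nonneg (by positivity), smul_eq_mul]
    calc y ^ (n - 1) * (min (K * y ^ 2) A / y ^ ((n : ℝ) + 2 * s))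
        = min (K * y ^ 2) A * (y ^ (n - 1) / y ^ ((n : ℝ) + 2 * s)) := by ring
      _ ≤ _ := by
          gcongr
          exact min_le_right _ _

theorem measurableSet_le_norm (ε : ℝ) : MeasurableSet {z : Rn n | ε ≤ ‖z‖} :=
  measurableSet_le measurable_const measurable_norm

theorem integrable_indicator_div_norm_rpow (hn : 1 ≤ n) {s : ℝ} (hs : s ∈ Ioo (0 : ℝ) 1)
    {ε : ℝ} (hε : 0 < ε) {A : ℝ} (hA : 0 ≤ A) :
    Integrable (fun z : Rn n =>
      {z : Rn n | ε ≤ ‖z‖}.indicator (fun z => A / ‖z‖ ^ ((n : ℝ) + 2 * s)) z) := by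
  -- With this `K`, the quadratic term is at least `A` once ‖z‖ ≥ ε, so the minimum is `A` there.
  have h := integrable_min_sq_div_norm_rpow hn hs (K := A / ε ^ 2) (by positivity) hA
  refine h.mono' ?_ (Eventually.of_forall fun z => ?_)
  · exact (Measurable.indicator (by fun_prop) (measurableSet_le_norm ε)).aestronglyMeasurable
  · by_cases hz : ε ≤ ‖z‖
    · rw [indicator_of_mem (by exact hz), Real.norm_of_nonneg (by positivity)]
      gcongr
      refine le_min ?_ le_rfl
      have : ε ^ 2 ≤ ‖z‖ ^ 2 := by gcongr
      rw [div_mul_eq_mul_div, le_div_iff₀ (by positivity)]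
      gcongr
    · rw [indicator_of_notMem (by exact hz), norm_zero]
      positivity

/-- By translation invariance the inner integral over the second variable does not depend on the
first, and `μ` is finite. -/
theorem integrable_comp_sub_prod {μ : Measure (Rn n)} [IsFiniteMeasure μ] {G : Rn n → ℝ}
    (hGm : Measurable G) (hG : Integrable G) :
    Integrable (fun p : Rn n × Rn n => G (p.1 - p.2)) (μ.prod volume) := by
  have hm : Measurable fun p : Rn n × Rn n => G (p.1 - p.2) := hGm.comp (by fun_prop)
  rw [integrable_prod_iff hm.aestronglyMeasurable]
  refine ⟨Eventually.of_forall fun x => hG.comp_sub_left x, ?_⟩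
  have : ∀ x : Rn n, ∫ y, ‖G (x - y)‖ = ∫ y, ‖G y‖ := fun x =>
    integral_sub_left_eq_self (fun y => ‖G y‖) volume x
  simp only [this]
  exact integrable_const _

/-! ### Second differences and the principal value. -/

/-- The symmetric second difference `2 v(x) - v(x + z) - v(x - z)`. -/
def secondDiff (v : Rn n → ℝ) (x z : Rn n) : ℝ := 2 * v x - v (x + z) - v (x - z)

theorem abs_secondDiff_le {v : Rn n → ℝ} {M : ℝ} (hM : ∀ x, |v x| ≤ M) (x z : Rn n) :
    |secondDiff v x z| ≤ 4 * M := by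
  have h1 := abs_le.1 (hM x)
  have h2 := abs_le.1 (hM (x + z))
  have h3 := abs_le.1 (hM (x - z))
  rw [secondDiff, abs_le]
  constructor <;> linarith

theorem integrableOn_diff_div (hn : 1 ≤ n) {s : ℝ} (hs : s ∈ Ioo (0 : ℝ) 1)
    {ε : ℝ} (hε : 0 < ε) {f : Rn n → ℝ} (hf : Measurable f) {A : ℝ} (hA : ∀ z, |f z| ≤ A) :
    IntegrableOn (fun z => f z / ‖z‖ ^ ((n : ℝ) + 2 * s)) {z : Rn n | ε ≤ ‖z‖} := by
  have hA0 : 0 ≤ A := (abs_nonneg _).trans (hA 0)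
  have h := integrable_indicator_div_norm_rpow hn hs hε hA0
  rw [integrable_indicator_iff (measurableSet_le_norm ε)] at h
  refine Integrable.mono' h (Measurable.aestronglyMeasurable (by fun_prop))
    (Eventually.of_forall fun z => ?_)
  rw [norm_div, Real.norm_of_nonneg (by positivity : 0 ≤ ‖z‖ ^ ((n : ℝ) + 2 * s))]
  gcongr
  exact hA z

theorem fracLaplacianTrunc_eq_sub (c s ε : ℝ) (v : Rn n → ℝ) (x : Rn n) :
    fracLaplacianTrunc c s ε v x =
      c * ∫ z in {z | ε ≤ ‖z‖}, (v x - v (x - z)) / ‖z‖ ^ ((n : ℝ) + 2 * s) := by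
  rw [fracLaplacianTrunc, ← integral_indicator (measurableSet_le_norm ε),
    ← integral_sub_left_eq_self _ volume x, ← integral_indicator
      (measurableSet_le measurable_const (by fun_prop))]
  simp only [indicator, mem_ofPred_eq, sub_sub_cancel]

theorem fracLaplacianTrunc_eq_add (c s ε : ℝ) (v : Rn n → ℝ) (x : Rn n) :
    fracLaplacianTrunc c s ε v x =
      c * ∫ z in {z | ε ≤ ‖z‖}, (v x - v (x + z)) / ‖z‖ ^ ((n : ℝ) + 2 * s) := by
  rw [fracLaplacianTrunc_eq_sub, ← integral_indicator (measurableSet_le_norm ε),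
    ← integral_neg_eq_self, ← integral_indicator (measurableSet_le_norm ε)]
  simp only [indicator, mem_ofPred_eq, norm_neg, sub_neg_eq_add]

/-- Averaging the forms in x - z and x + z cancels the odd first-order part. With a quadratic bound
on the second difference, what remains is absolutely integrable up to z = 0. -/
theorem fracLaplacianTrunc_eq_secondDiff (hn : 1 ≤ n) {c s : ℝ} (hs : s ∈ Ioo (0 : ℝ) 1)
    {ε : ℝ} (hε : 0 < ε) {v : Rn n → ℝ} (hv : Continuous v) {M : ℝ} (hM : ∀ x, |v x| ≤ M)
    (x : Rn n) :
    fracLaplacianTrunc c s ε v x =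
      c / 2 * ∫ z in {z | ε ≤ ‖z‖}, secondDiff v x z / ‖z‖ ^ ((n : ℝ) + 2 * s) := by
  have hb : ∀ y, |v x - v y| ≤ 2 * M := fun y => by
    have h1 := abs_le.1 (hM x)
    have h2 := abs_le.1 (hM y)
    rw [abs_le]
    constructor <;> linarith
  have h1 := integrableOn_diff_div hn hs hε (f := fun z => v x - v (x + z)) (by fun_prop)
    fun z => hb _
  have h2 := integrableOn_diff_div hn hs hε (f := fun z => v x - v (x - z)) (by fun_prop)
    fun z => hb _
  have h3 : ∫ z in {z | ε ≤ ‖z‖}, secondDiff v x z / ‖z‖ ^ ((n : ℝ) + 2 * s) =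
      (∫ z in {z | ε ≤ ‖z‖}, (v x - v (x + z)) / ‖z‖ ^ ((n : ℝ) + 2 * s)) +
      ∫ z in {z | ε ≤ ‖z‖}, (v x - v (x - z)) / ‖z‖ ^ ((n : ℝ) + 2 * s) := by
    rw [← integral_add h1 h2]
    congr 1
    ext z
    rw [secondDiff]
    ring
  rw [h3]
  have e1 := fracLaplacianTrunc_eq_sub c s ε v x
  have e2 := fracLaplacianTrunc_eq_add c s ε v x
  linear_combination (1 / 2) * e1 + (1 / 2) * e2

theorem abs_secondDiff_div_le {s : ℝ} {v : Rn n → ℝ} {M : ℝ} (hM : ∀ x, |v x| ≤ M) {x : Rn n}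
    {K : ℝ} (hK : ∀ z, |secondDiff v x z| ≤ K * ‖z‖ ^ 2) (z : Rn n) :
    ‖secondDiff v x z / ‖z‖ ^ ((n : ℝ) + 2 * s)‖ ≤
      min (K * ‖z‖ ^ 2) (4 * M) / ‖z‖ ^ ((n : ℝ) + 2 * s) := by
  rw [norm_div, Real.norm_of_nonneg (by positivity : 0 ≤ ‖z‖ ^ ((n : ℝ) + 2 * s))]
  gcongr
  exact le_min (hK z) (abs_secondDiff_le hM x z)

/-- The bound does not depend on ε, and depends on `v` and `x` only through `K` and `M`: this is the
domination used later in the limit ε ↓ 0 over all crossed leaves. -/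
theorem abs_fracLaplacianTrunc_le (hn : 1 ≤ n) {c s : ℝ} (hc : 0 < c) (hs : s ∈ Ioo (0 : ℝ) 1)
    {ε : ℝ} (hε : 0 < ε) {v : Rn n → ℝ} (hv : Continuous v) {M : ℝ} (hM : ∀ x, |v x| ≤ M)
    {x : Rn n} {K : ℝ} (hK0 : 0 ≤ K) (hK : ∀ z, |secondDiff v x z| ≤ K * ‖z‖ ^ 2) :
    |fracLaplacianTrunc c s ε v x| ≤
      c / 2 * ∫ z : Rn n, min (K * ‖z‖ ^ 2) (4 * M) / ‖z‖ ^ ((n : ℝ) + 2 * s) := by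
  have hM0 : 0 ≤ M := (abs_nonneg _).trans (hM 0)
  have hint := integrable_min_sq_div_norm_rpow hn hs hK0 (by positivity : 0 ≤ 4 * M)
  rw [fracLaplacianTrunc_eq_secondDiff hn hs hε hv hM, abs_mul, abs_of_pos (by positivity)]
  gcongr
  calc |∫ z in {z | ε ≤ ‖z‖}, secondDiff v x z / ‖z‖ ^ ((n : ℝ) + 2 * s)|
      ≤ ∫ z in {z : Rn n | ε ≤ ‖z‖}, min (K * ‖z‖ ^ 2) (4 * M) / ‖z‖ ^ ((n : ℝ) + 2 * s) :=
        norm_integral_le_of_norm_le hint.integrableOn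
          (Eventually.of_forall (abs_secondDiff_div_le hM hK))
    _ ≤ _ := setIntegral_le_integral hint (Eventually.of_forall fun z => by positivity)

theorem tendsto_fracLaplacianTrunc (hn : 1 ≤ n) (c : ℝ) {s : ℝ} (hs : s ∈ Ioo (0 : ℝ) 1)
    {v : Rn n → ℝ} (hv : Continuous v) {M : ℝ} (hM : ∀ x, |v x| ≤ M)
    {x : Rn n} {K : ℝ} (hK0 : 0 ≤ K) (hK : ∀ z, |secondDiff v x z| ≤ K * ‖z‖ ^ 2) :
    Tendsto (fun ε => fracLaplacianTrunc c s ε v x) (𝓝[>] 0) (𝓝 (fracLaplacian c s v x)) := by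
  have hM0 : 0 ≤ M := (abs_nonneg _).trans (hM 0)
  have hint := integrable_min_sq_div_norm_rpow hn hs hK0 (by positivity : 0 ≤ 4 * M)
  have hmeas : Measurable fun z => secondDiff v x z / ‖z‖ ^ ((n : ℝ) + 2 * s) := by
    unfold secondDiff
    fun_prop
  suffices h : Tendsto (fun ε => fracLaplacianTrunc c s ε v x) (𝓝[>] 0)
      (𝓝 (c / 2 * ∫ z, secondDiff v x z / ‖z‖ ^ ((n : ℝ) + 2 * s))) from
    tendsto_nhds_limUnder ⟨_, h⟩
  have hlim : Tendsto (fun ε : ℝ => ∫ z, {z : Rn n | ε ≤ ‖z‖}.indicator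
      (fun z => secondDiff v x z / ‖z‖ ^ ((n : ℝ) + 2 * s)) z) (𝓝[>] 0)
      (𝓝 (∫ z, secondDiff v x z / ‖z‖ ^ ((n : ℝ) + 2 * s))) := by
    refine tendsto_integral_filter_of_dominated_convergence _
      (Eventually.of_forall fun ε =>
        (hmeas.indicator (measurableSet_le_norm ε)).aestronglyMeasurable)
      (Eventually.of_forall fun ε => Eventually.of_forall fun z =>
        (norm_indicator_le_norm_self _ z).trans (abs_secondDiff_div_le hM hK z)) hint
      (Eventually.of_forall fun z => ?_)
    refine tendsto_const_nhds.congr' ?_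
    rcases eq_or_ne z 0 with rfl | hz
    -- At z = 0 the second difference vanishes, so the truncation is irrelevant there.
    · refine Eventually.of_forall fun ε => ?_
      simp [secondDiff, indicator, two_mul]
    · have : Iio ‖z‖ ∈ 𝓝[>] (0 : ℝ) := mem_nhdsWithin_of_mem_nhds (Iio_mem_nhds (norm_pos_iff.2 hz))
      filter_upwards [this] with ε hε
      rw [indicator_of_mem]
      exact (mem_Iio.1 hε).le
  refine (hlim.const_mul (c / 2)).congr' ?_
  filter_upwards [self_mem_nhdsWithin] with ε hε
  rw [fracLaplacianTrunc_eq_secondDiff hn hs hε hv hM, integral_indicator (measurableSet_le_norm ε)]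

/-! ### The leaf parameter: order, continuity, vertical sections. -/

theorem IsField.continuous_leaf (hu : IsField I u) {t : ℝ} (ht : t ∈ I) : Continuous (u t) :=
  hu.continuousOn.comp_continuous (by fun_prop : Continuous fun x : Rn n => (x, t))
    fun _ => ⟨mem_univ _, ht⟩

theorem leafParam_mem (x : Rn n) {l : ℝ} (h : (x, l) ∈ foliatedRegion I u) :
    leafParam I u x l ∈ I := (leafParam_spec h).1

theorem apply_leafParam (x : Rn n) {l : ℝ} (h : (x, l) ∈ foliatedRegion I u) :
    u (leafParam I u x l) x = l := (leafParam_spec h).2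

/-- Strict monotonicity in the parameter turns comparisons of parameters into comparisons of
heights, which are open conditions in the point. -/
theorem IsField.lt_leafParam_iff (hu : IsField I u) {x : Rn n} {l t : ℝ} (ht : t ∈ I)
    (h : (x, l) ∈ foliatedRegion I u) : t < leafParam I u x l ↔ u t x < l := by
  conv_rhs => rw [← apply_leafParam x h]
  exact ((hu.strictMonoOn_param x).lt_iff_lt ht (leafParam_mem x h)).symm

theorem IsField.leafParam_lt_iff (hu : IsField I u) {x : Rn n} {l t : ℝ} (ht : t ∈ I)
    (h : (x, l) ∈ foliatedRegion I u) : leafParam I u x l < t ↔ l < u t x := by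
  conv_rhs => rw [← apply_leafParam x h]
  exact ((hu.strictMonoOn_param x).lt_iff_lt (leafParam_mem x h) ht).symm

/-- The leaf parameter depends continuously on the point of the foliated region. -/
theorem IsField.continuousOn_leafParam (hI : I.OrdConnected) (hu : IsField I u) :
    ContinuousOn (fun p : Rn n × ℝ => leafParam I u p.1 p.2) (foliatedRegion I u) := by
  rintro ⟨x₀, l₀⟩ h₀
  have hmem := leafParam_mem x₀ h₀
  refine tendsto_order.2 ⟨fun a ha => ?_, fun a ha => ?_⟩
  · by_cases haI : a ∈ I
    · have h1 := (hu.lt_leafParam_iff haI h₀).1 ha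
      have h2 : ∀ᶠ p : Rn n × ℝ in 𝓝 (x₀, l₀), u a p.1 < p.2 :=
        (((hu.continuous_leaf haI).comp continuous_fst).tendsto (x₀, l₀)).eventually_lt
          (continuous_snd.tendsto (x₀, l₀)) h1
      filter_upwards [self_mem_nhdsWithin, nhdsWithin_le_nhds h2] with p hp hlt
      exact (hu.lt_leafParam_iff haI hp).2 hlt
    -- If `a` is outside the interval `I` but below one of its points, it is below all of them.
    · filter_upwards [self_mem_nhdsWithin] with p hp
      by_contra! hle
      exact haI (hI.out (leafParam_mem p.1 hp) hmem ⟨hle, ha.le⟩)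
  · by_cases haI : a ∈ I
    · have h1 := (hu.leafParam_lt_iff haI h₀).1 ha
      have h2 : ∀ᶠ p : Rn n × ℝ in 𝓝 (x₀, l₀), p.2 < u a p.1 :=
        (continuous_snd.tendsto (x₀, l₀)).eventually_lt
          (((hu.continuous_leaf haI).comp continuous_fst).tendsto (x₀, l₀)) h1
      filter_upwards [self_mem_nhdsWithin, nhdsWithin_le_nhds h2] with p hp hlt
      exact (hu.leafParam_lt_iff haI hp).2 hlt
    · filter_upwards [self_mem_nhdsWithin] with p hp
      by_contra! hle
      exact haI (hI.out hmem (leafParam_mem p.1 hp) ⟨ha.le, hle⟩)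

/-- The vertical sections of the foliated region are intervals. -/
theorem IsField.mem_foliatedRegion_of_mem_uIcc (hI : I.OrdConnected) (hu : IsField I u)
    {x : Rn n} {a b l : ℝ} (ha : (x, a) ∈ foliatedRegion I u) (hb : (x, b) ∈ foliatedRegion I u)
    (hl : l ∈ uIcc a b) : (x, l) ∈ foliatedRegion I u := by
  obtain ⟨t, ht, hat⟩ := ha
  obtain ⟨r, hr, hbr⟩ := hb
  dsimp only at hat hbr
  subst hat hbr
  have hsub : uIcc t r ⊆ I := hI.uIcc_subset ht hr
  have hc : ContinuousOn (fun τ => u τ x) (uIcc t r) :=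
    ((hu.contDiffOn_param x).continuousOn).mono hsub
  obtain ⟨τ, hτ, h⟩ := intermediate_value_uIcc hc hl
  exact ⟨τ, hsub hτ, h.symm⟩

/-! ### Local regularity bounds for the leaves. -/

/-- A `C¹` function with Lipschitz derivative in a ball has quadratic second differences. -/
theorem abs_secondDiff_le_of_lipschitz_fderiv {v : Rn n → ℝ} {v' : Rn n → Rn n →L[ℝ] ℝ}
    {x : Rn n} {r L : ℝ} (hv : ∀ y ∈ Metric.ball x r, HasFDerivAt v (v' y) y)
    (hL : ∀ y ∈ Metric.ball x r, ∀ y' ∈ Metric.ball x r, ‖v' y - v' y'‖ ≤ L * ‖y - y'‖)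
    (hL0 : 0 ≤ L) {z : Rn n} (hz : ‖z‖ < r) :
    |secondDiff v x z| ≤ 2 * L * ‖z‖ ^ 2 := by
  have hmem : ∀ y ∈ Metric.closedBall (0 : Rn n) ‖z‖,
      x + y ∈ Metric.ball x r ∧ x - y ∈ Metric.ball x r := by
    intro y hy
    rw [mem_closedBall_zero_iff] at hy
    constructor <;> simpa [Metric.mem_ball, dist_eq_norm] using hy.trans_lt hz
  -- Mean value inequality for y ↦ v(x + y) + v(x - y): its derivative is a difference of `v'` at
  -- points 2y apart, so the Lipschitz bound supplies the second power of ‖z‖.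
  have hder : ∀ y ∈ Metric.closedBall (0 : Rn n) ‖z‖,
      HasFDerivWithinAt (fun y => v (x + y) + v (x - y)) (v' (x + y) - v' (x - y))
        (Metric.closedBall 0 ‖z‖) y := by
    intro y hy
    have h1 : HasFDerivAt (fun y => v (x + y)) (v' (x + y)) y := by
      have := (hv _ (hmem y hy).1).comp y ((hasFDerivAt_id y).const_add x)
      simpa [Function.comp_def] using this
    have h2 : HasFDerivAt (fun y => v (x - y)) (-v' (x - y)) y := by
      have := (hv _ (hmem y hy).2).comp y ((hasFDerivAt_id y).const_sub x)
      simpa [Function.comp_def] using this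
    rw [sub_eq_add_neg (v' (x + y))]
    exact (h1.add h2).hasFDerivWithinAt
  have hbound : ∀ y ∈ Metric.closedBall (0 : Rn n) ‖z‖,
      ‖v' (x + y) - v' (x - y)‖ ≤ 2 * L * ‖z‖ := by
    intro y hy
    refine (hL _ (hmem y hy).1 _ (hmem y hy).2).trans ?_
    have e : x + y - (x - y) = (2 : ℝ) • y := by
      rw [two_smul]
      abel
    rw [e, norm_smul]
    rw [mem_closedBall_zero_iff] at hy
    norm_num
    nlinarith
  have h := (convex_closedBall (0 : Rn n) ‖z‖).norm_image_sub_le_of_norm_hasFDerivWithin_le hder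
    hbound (Metric.mem_closedBall_self (norm_nonneg z)) (mem_closedBall_zero_iff.2 le_rfl)
  have e : secondDiff v x z = -(v (x + z) + v (x - z) - (v (x + 0) + v (x - 0))) := by
    simp only [secondDiff, add_zero, sub_zero]
    ring
  rw [e, abs_neg]
  simpa [sq, mul_assoc] using h

/-- Near each point of `ℝⁿ × I`, the leaves have uniformly quadratic second differences. -/
theorem IsC2Field.exists_secondDiff_bound_nhds (hI : I.OrdConnected) (hu : IsC2Field I u)
    {M : ℝ} (hM : ∀ t ∈ I, ∀ x, |u t x| ≤ M) {q : Rn n × ℝ} (hq : q.2 ∈ I) :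
    ∃ N ∈ 𝓝 q, ∃ K : ℝ, 0 ≤ K ∧ ∀ p ∈ N, p.2 ∈ I → ∀ z, |secondDiff (u p.2) p.1 z| ≤ K * ‖z‖ ^ 2 := by
  have hconv : Convex ℝ ((univ : Set (Rn n)) ×ˢ I) := convex_univ.prod hI.convex
  have hqm : q ∈ (univ : Set (Rn n)) ×ˢ I := ⟨mem_univ _, hq⟩
  have hcd : ContDiffWithinAt ℝ (1 + 1) (fun p : Rn n × ℝ => u p.2 p.1) (univ ×ˢ I) q := by
    rw [one_add_one_eq_two]
    exact hu.contDiffOn q hqm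
  obtain ⟨U, hU, -, -, f', hf', hcd'⟩ :=
    (contDiffWithinAt_succ_iff_hasFDerivWithinAt' (by norm_num)).1 hcd
  rw [insert_eq_of_mem hqm] at hU
  -- Convexity of ℝⁿ × I makes the C¹ derivative Lipschitz near `q` within the set, even when `q.2`
  -- is an endpoint of `I`.
  obtain ⟨L, V, hV, hLip⟩ := hcd'.exists_lipschitzOnWith hconv
  obtain ⟨r, hr, hball⟩ := Metric.mem_nhdsWithin_iff.1 (inter_mem hU hV)
  have hM0 : 0 ≤ M := (abs_nonneg _).trans (hM q.2 hq 0)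
  have hprod : ∀ p ∈ Metric.ball q (r / 2), p.2 ∈ I → ∀ y ∈ Metric.ball p.1 (r / 2),
      (y, p.2) ∈ U ∩ V := by
    intro p hp hpI y hy
    refine hball ⟨?_, mem_univ _, hpI⟩
    rw [Metric.mem_ball] at *
    calc dist (y, p.2) q ≤ dist (y, p.2) p + dist p q := dist_triangle _ _ _
      _ < r / 2 + r / 2 := by
        refine add_lt_add ?_ hp
        rw [Prod.dist_eq]
        simpa using hy
      _ = r := add_halves r
  refine ⟨Metric.ball q (r / 2), Metric.ball_mem_nhds _ (by positivity),
    -- The first constant serves ‖z‖ < r/2 through the Lipschitz derivative; the second absorbs the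
    -- trivial bound 4M when ‖z‖ ≥ r/2.
    max (2 * L) (4 * M / (r / 2) ^ 2), by positivity, fun p hp hpI z => ?_⟩
  rcases lt_or_ge ‖z‖ (r / 2) with hz | hz
  · have key := abs_secondDiff_le_of_lipschitz_fderiv (v := u p.2)
      (v' := fun y => (f' (y, p.2)).comp (ContinuousLinearMap.inl ℝ (Rn n) ℝ))
      (x := p.1) (r := r / 2) (L := L) ?_ ?_ L.coe_nonneg hz
    · refine key.trans ?_
      gcongr
      exact le_max_left _ _
    · intro y hy
      have h1 := hf' (y, p.2) (hprod p hp hpI y hy).1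
      have h2 : HasFDerivWithinAt (fun x : Rn n => (x, p.2)) (ContinuousLinearMap.inl ℝ (Rn n) ℝ)
          univ y := (hasFDerivAt_prodMk_left y p.2).hasFDerivWithinAt
      have h3 := h1.comp y h2 (fun x _ => (⟨mem_univ x, hpI⟩ : (x, p.2) ∈ (univ : Set (Rn n)) ×ˢ I))
      rwa [hasFDerivWithinAt_univ] at h3
    · intro y hy y' hy'
      have h1 := hLip.norm_sub_le (hprod p hp hpI y hy).2 (hprod p hp hpI y' hy').2
      rw [← ContinuousLinearMap.sub_comp]
      calc _ ≤ ‖f' (y, p.2) - f' (y', p.2)‖ * ‖ContinuousLinearMap.inl ℝ (Rn n) ℝ‖ :=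
            ContinuousLinearMap.opNorm_comp_le _ _
        _ ≤ ‖f' (y, p.2) - f' (y', p.2)‖ * 1 := by
            gcongr
            exact ContinuousLinearMap.norm_inl_le_one ℝ (Rn n) ℝ
        _ ≤ _ := by
            rw [mul_one]
            refine h1.trans_eq ?_
            simp [Prod.norm_def]
  · refine (abs_secondDiff_le (hM p.2 hpI) p.1 z).trans ?_
    calc 4 * M = 4 * M / (r / 2) ^ 2 * (r / 2) ^ 2 := by field_simp
      _ ≤ max (2 * (L : ℝ)) (4 * M / (r / 2) ^ 2) * ‖z‖ ^ 2 := by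
        gcongr
        exact le_max_right _ _

theorem IsC2Field.exists_secondDiff_bound (hI : I.OrdConnected) (hu : IsC2Field I u)
    {M : ℝ} (hM : ∀ t ∈ I, ∀ x, |u t x| ≤ M) {S : Set (Rn n × ℝ)} (hS : IsCompact S)
    (hSI : ∀ p ∈ S, p.2 ∈ I) :
    ∃ K : ℝ, 0 ≤ K ∧ ∀ p ∈ S, ∀ z, |secondDiff (u p.2) p.1 z| ≤ K * ‖z‖ ^ 2 := by
  -- Membership in `I` is carried inside the statement because the compactness induction ranges over
  -- arbitrary sets, including full neighbourhoods that leave ℝⁿ × I.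
  have h : ∃ K : ℝ, 0 ≤ K ∧ ∀ p ∈ S, p.2 ∈ I → ∀ z, |secondDiff (u p.2) p.1 z| ≤ K * ‖z‖ ^ 2 := by
    refine hS.induction_on (p := fun S => ∃ K : ℝ, 0 ≤ K ∧ ∀ p ∈ S, p.2 ∈ I → ∀ z,
      |secondDiff (u p.2) p.1 z| ≤ K * ‖z‖ ^ 2) ⟨0, le_rfl, by simp⟩ ?_ ?_ ?_
    · rintro A B hAB ⟨K, hK0, hK⟩
      exact ⟨K, hK0, fun p hp => hK p (hAB hp)⟩
    · rintro A B ⟨K, hK0, hK⟩ ⟨K', hK0', hK'⟩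
      refine ⟨max K K', le_max_of_le_left hK0, ?_⟩
      rintro p (hp | hp) hpI z
      · refine (hK p hp hpI z).trans ?_
        gcongr
        exact le_max_left _ _
      · refine (hK' p hp hpI z).trans ?_
        gcongr
        exact le_max_right _ _
    · intro q hq
      obtain ⟨N, hN, K, hK0, hK⟩ := hu.exists_secondDiff_bound_nhds hI hM (hSI q hq)
      exact ⟨N, mem_nhdsWithin_of_mem_nhds hN, K, hK0, hK⟩
  obtain ⟨K, hK0, hK⟩ := h
  exact ⟨K, hK0, fun p hp => hK p hp (hSI p hp)⟩

theorem IsC2Field.contDiff_leaf (hu : IsC2Field I u) {t : ℝ} (ht : t ∈ I) :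
    ContDiff ℝ 2 (u t) := by
  rw [← contDiffOn_univ]
  exact hu.contDiffOn.comp (f := fun x : Rn n => (x, t)) (by fun_prop)
    fun _ _ => ⟨mem_univ _, ht⟩

/-- A bounded `C¹` function is Lipschitz at the points of a compact set, with a uniform constant. -/
theorem exists_lipschitz_bound {v : Rn n → ℝ} (hv : ContDiff ℝ 1 v) {M : ℝ} (hM : ∀ x, |v x| ≤ M)
    {S : Set (Rn n)} (hS : IsCompact S) :
    ∃ L : ℝ, 0 ≤ L ∧ ∀ x ∈ S, ∀ y, |v x - v y| ≤ L * ‖x - y‖ := by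
  have hM0 : 0 ≤ M := (abs_nonneg _).trans (hM 0)
  refine hS.induction_on (p := fun S => ∃ L : ℝ, 0 ≤ L ∧ ∀ x ∈ S, ∀ y, |v x - v y| ≤ L * ‖x - y‖)
    ⟨0, le_rfl, by simp⟩ ?_ ?_ ?_
  · rintro A B hAB ⟨K, hK0, hK⟩
    exact ⟨K, hK0, fun p hp => hK p (hAB hp)⟩
  · rintro A B ⟨K, hK0, hK⟩ ⟨K', hK0', hK'⟩
    refine ⟨max K K', le_max_of_le_left hK0, ?_⟩
    rintro p (hp | hp) z
    · refine (hK p hp z).trans ?_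
      gcongr
      exact le_max_left _ _
    · refine (hK' p hp z).trans ?_
      gcongr
      exact le_max_right _ _
  · intro q _
    obtain ⟨L, V, hV, hL⟩ := hv.contDiffAt.exists_lipschitzOnWith (x := q)
    obtain ⟨r, hr, hball⟩ := Metric.mem_nhds_iff.1 hV
    refine ⟨Metric.ball q (r / 2), mem_nhdsWithin_of_mem_nhds (Metric.ball_mem_nhds _ (by positivity)),
      max L (2 * M / (r / 2)), by positivity, fun x hx y => ?_⟩
    rcases lt_or_ge ‖x - y‖ (r / 2) with hz | hz
    · have hxV : x ∈ V := hball (Metric.ball_subset_ball (by linarith) hx)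
      have hyV : y ∈ V := by
        refine hball ?_
        rw [← dist_eq_norm, dist_comm] at hz
        rw [Metric.mem_ball] at *
        linarith [dist_triangle y x q]
      refine (hL.norm_sub_le hxV hyV).trans ?_
      gcongr
      exact le_max_left _ _
    · have h1 := abs_le.1 (hM x)
      have h2 := abs_le.1 (hM y)
      calc |v x - v y| ≤ 2 * M := by
            rw [abs_le]
            constructor <;> linarith
        _ = 2 * M / (r / 2) * (r / 2) := by field_simp
        _ ≤ _ := by
          gcongr
          exact le_max_right _ _

/-! ### The leaves crossed between the base leaf and a competitor. -/

/-- The level `(1 - θ) u^{t₀}(x) + θ w(x)`, with `θ` clamped to `[0, 1]`. -/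
def leafLevel (u : ℝ → Rn n → ℝ) (t₀ : ℝ) (w : Rn n → ℝ) (x : Rn n) (θ : ℝ) : ℝ :=
  u t₀ x + (w x - u t₀ x) * max 0 (min 1 θ)

/-- The parameter of the leaf through `(x, leafLevel u t₀ w x θ)`. -/
def leafTime (I : Set ℝ) (u : ℝ → Rn n → ℝ) (t₀ : ℝ) (w : Rn n → ℝ) (x : Rn n) (θ : ℝ) : ℝ :=
  leafParam I u x (leafLevel u t₀ w x θ)

theorem leafLevel_of_mem {θ : ℝ} (hθ : θ ∈ Icc (0 : ℝ) 1) (x : Rn n) :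
    leafLevel u t₀ w x θ = u t₀ x + (w x - u t₀ x) * θ := by
  rw [leafLevel, min_eq_right hθ.2, max_eq_right hθ.1]

theorem leafTime_clamp (x : Rn n) (θ : ℝ) :
    leafTime I u t₀ w x (max 0 (min 1 θ)) = leafTime I u t₀ w x θ := by
  have h : max 0 (min 1 θ) ∈ Icc (0 : ℝ) 1 := ⟨le_max_left _ _, by simp⟩
  rw [leafTime, leafLevel_of_mem h, leafTime, leafLevel]

/-- Clamping θ makes this true for every real θ, so `leafTime` is continuous on all of ℝⁿ × ℝ and no
subtypes are needed for measurability. -/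
theorem leafLevel_mem (hI : I.OrdConnected) (hu : IsField I u) (ht₀ : t₀ ∈ I)
    (hw : w ∈ admissible I u) (x : Rn n) (θ : ℝ) :
    (x, leafLevel u t₀ w x θ) ∈ foliatedRegion I u := by
  refine hu.mem_foliatedRegion_of_mem_uIcc hI (a := u t₀ x) (b := w x) ⟨t₀, ht₀, rfl⟩ (hw.2.2 x) ?_
  have h0 : (0 : ℝ) ≤ max 0 (min 1 θ) := le_max_left _ _
  have h1 : max 0 (min 1 θ) ≤ (1 : ℝ) := by simp
  rw [leafLevel, mem_uIcc]
  rcases le_total (u t₀ x) (w x) with h | h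
  · left
    constructor <;> nlinarith
  · right
    constructor <;> nlinarith

theorem leafTime_mem (hI : I.OrdConnected) (hu : IsField I u) (ht₀ : t₀ ∈ I)
    (hw : w ∈ admissible I u) (x : Rn n) (θ : ℝ) : leafTime I u t₀ w x θ ∈ I :=
  leafParam_mem x (leafLevel_mem hI hu ht₀ hw x θ)

theorem apply_leafTime (hI : I.OrdConnected) (hu : IsField I u) (ht₀ : t₀ ∈ I)
    (hw : w ∈ admissible I u) (x : Rn n) (θ : ℝ) :
    u (leafTime I u t₀ w x θ) x = leafLevel u t₀ w x θ :=
  apply_leafParam x (leafLevel_mem hI hu ht₀ hw x θ)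

theorem continuous_leafLevel (hu : IsField I u) (ht₀ : t₀ ∈ I) (hw : w ∈ admissible I u) :
    Continuous fun p : Rn n × ℝ => leafLevel u t₀ w p.1 p.2 := by
  have h1 := hu.continuous_leaf ht₀
  have h2 := hw.1
  unfold leafLevel
  fun_prop

theorem continuous_leafTime (hI : I.OrdConnected) (hu : IsField I u) (ht₀ : t₀ ∈ I)
    (hw : w ∈ admissible I u) : Continuous fun p : Rn n × ℝ => leafTime I u t₀ w p.1 p.2 :=
  (hu.continuousOn_leafParam hI).comp_continuous
    (continuous_fst.prodMk (continuous_leafLevel hu ht₀ hw))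
    fun p => leafLevel_mem hI hu ht₀ hw p.1 p.2

theorem continuous_apply_leafTime (hI : I.OrdConnected) (hu : IsField I u) (ht₀ : t₀ ∈ I)
    (hw : w ∈ admissible I u) :
    Continuous fun p : (Rn n × ℝ) × Rn n => u (leafTime I u t₀ w p.1.1 p.1.2) p.2 :=
  hu.continuousOn.comp_continuous
    (continuous_snd.prodMk ((continuous_leafTime hI hu ht₀ hw).comp continuous_fst))
    fun p => ⟨mem_univ _, leafTime_mem hI hu ht₀ hw p.1.1 p.1.2⟩

theorem abs_admissible_le {M : ℝ} (hM : ∀ t ∈ I, ∀ x, |u t x| ≤ M) (hw : w ∈ admissible I u)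
    (x : Rn n) : |w x| ≤ M := by
  obtain ⟨t, ht, h⟩ := hw.2.2 x
  dsimp only at h
  rw [h]
  exact hM t ht x

/-- Uniform quadratic bound of the second differences of the leaves crossed between `u^{t₀}`
and `w` over a bounded set. -/
theorem exists_secondDiff_bound_leafTime (hI : I.OrdConnected) (hu : IsC2Field I u)
    {M : ℝ} (hM : ∀ t ∈ I, ∀ x, |u t x| ≤ M) (ht₀ : t₀ ∈ I)
    (hw : w ∈ admissible I u) {Ω : Set (Rn n)} (hΩ : Bornology.IsBounded Ω) :
    ∃ K : ℝ, 0 ≤ K ∧ ∀ x ∈ Ω, ∀ θ z,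
      |secondDiff (u (leafTime I u t₀ w x θ)) x z| ≤ K * ‖z‖ ^ 2 := by
  have hf : Continuous fun p : Rn n × ℝ => (p.1, leafTime I u t₀ w p.1 p.2) :=
    continuous_fst.prodMk (continuous_leafTime hI hu.toIsField ht₀ hw)
  -- The crossed pairs (x, t) over the closure of Ω form a compact set: a continuous image of
  -- closure Ω × [0, 1], which by clamping covers every θ.
  have hS := (hΩ.isCompact_closure.prod (isCompact_Icc (a := (0 : ℝ)) (b := 1))).image hf
  obtain ⟨K, hK0, hK⟩ := hu.exists_secondDiff_bound hI hM hS (by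
    rintro _ ⟨p, -, rfl⟩
    exact leafTime_mem hI hu.toIsField ht₀ hw _ _)
  refine ⟨K, hK0, fun x hx θ z => ?_⟩
  have := hK _ ⟨(x, max 0 (min 1 θ)), ⟨subset_closure hx, le_max_left _ _, by simp⟩, rfl⟩ z
  dsimp only at this
  rwa [leafTime_clamp] at this

/-! ### The density of the calibration: bounds, measurability and Fubini. -/

/-- The unit interval with Lebesgue measure, as parameter space of the leaves crossed. -/
abbrev unitMeasure : Measure ℝ := volume.restrict (Ioc 0 1)

/-- `(u^t(x) - u^t(y)) / |x - y|^{n+2s}` at `t = leafTime x θ`. -/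
def leafKernel (s : ℝ) (I : Set ℝ) (u : ℝ → Rn n → ℝ) (t₀ : ℝ) (w : Rn n → ℝ)
    (x : Rn n) (θ : ℝ) (y : Rn n) : ℝ :=
  (u (leafTime I u t₀ w x θ) x - u (leafTime I u t₀ w x θ) y) / ‖x - y‖ ^ ((n : ℝ) + 2 * s)

theorem measurable_leafKernel (s : ℝ) (hI : I.OrdConnected) (hu : IsField I u) (ht₀ : t₀ ∈ I)
    (hw : w ∈ admissible I u) :
    Measurable fun p : (Rn n × ℝ) × Rn n => leafKernel s I u t₀ w p.1.1 p.1.2 p.2 := by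
  have h1 := (continuous_apply_leafTime hI hu ht₀ hw).measurable
  have h2 : Measurable fun p : (Rn n × ℝ) × Rn n => u (leafTime I u t₀ w p.1.1 p.1.2) p.1.1 :=
    h1.comp (g := fun p : (Rn n × ℝ) × Rn n => u (leafTime I u t₀ w p.1.1 p.1.2) p.2)
      (f := fun p : (Rn n × ℝ) × Rn n => (p.1, p.1.1)) (by fun_prop)
  exact (h2.sub h1).div (by fun_prop)

theorem abs_leafKernel_le {s : ℝ} (hI : I.OrdConnected) (hu : IsField I u) (ht₀ : t₀ ∈ I)
    (hw : w ∈ admissible I u) {M : ℝ} (hM : ∀ t ∈ I, ∀ x, |u t x| ≤ M) (x : Rn n) (θ : ℝ)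
    (y : Rn n) :
    |leafKernel s I u t₀ w x θ y| ≤ 2 * M / ‖x - y‖ ^ ((n : ℝ) + 2 * s) := by
  have ht := leafTime_mem hI hu ht₀ hw x θ
  have h1 := abs_le.1 (hM _ ht x)
  have h2 := abs_le.1 (hM _ ht y)
  rw [leafKernel, abs_div, abs_of_nonneg (by positivity : 0 ≤ ‖x - y‖ ^ ((n : ℝ) + 2 * s))]
  gcongr
  rw [abs_le]
  constructor <;> linarith

/-- The inner integral of the calibration functional, rescaled to the unit interval. -/
theorem pvDensity_eq (s : ℝ) (x y : Rn n) :
    pvDensity s I u t₀ w (x, y) =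
      ∫ θ, (w x - u t₀ x) * leafKernel s I u t₀ w x θ y ∂unitMeasure := by
  -- Affine substitution with the slope kept as a factor, so it also covers w(x) = u^{t₀}(x).
  have h := intervalIntegral.mul_integral_comp_add_mul (a := 0) (b := 1)
    (f := leafQuotient s I u x y) (w x - u t₀ x) (u t₀ x)
  rw [mul_zero, add_zero, mul_one, add_sub_cancel] at h
  rw [pvDensity, ← h, ← intervalIntegral.integral_const_mul,
    intervalIntegral.integral_of_le zero_le_one]
  refine setIntegral_congr_fun measurableSet_Ioc fun θ hθ => ?_
  rw [leafQuotient, leafKernel, leafTime, leafLevel_of_mem ⟨hθ.1.le, hθ.2⟩]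

theorem measurable_pvDensity (s : ℝ) (hI : I.OrdConnected) (hu : IsField I u) (ht₀ : t₀ ∈ I)
    (hw : w ∈ admissible I u) : Measurable (pvDensity s I u t₀ w) := by
  have e : pvDensity s I u t₀ w = fun p : Rn n × Rn n =>
      ∫ θ, (w p.1 - u t₀ p.1) * leafKernel s I u t₀ w p.1 θ p.2 ∂unitMeasure :=
    funext fun p => pvDensity_eq s p.1 p.2
  rw [e]
  have h1 := hw.1.measurable
  have h2 := (hu.continuous_leaf ht₀).measurable
  have h3 : Measurable fun q : (Rn n × Rn n) × ℝ => leafKernel s I u t₀ w q.1.1 q.2 q.1.2 :=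
    (measurable_leafKernel s hI hu ht₀ hw).comp
      (f := fun q : (Rn n × Rn n) × ℝ => ((q.1.1, q.2), q.1.2)) (by fun_prop)
  have h4 : Measurable fun q : (Rn n × Rn n) × ℝ =>
      (w q.1.1 - u t₀ q.1.1) * leafKernel s I u t₀ w q.1.1 q.2 q.1.2 := by fun_prop
  exact (h4.stronglyMeasurable.integral_prod_right (f := fun (p : Rn n × Rn n) (θ : ℝ) =>
    (w p.1 - u t₀ p.1) * leafKernel s I u t₀ w p.1 θ p.2)).measurable

theorem abs_pvDensity_le {s : ℝ} (hI : I.OrdConnected) (hu : IsField I u) (ht₀ : t₀ ∈ I)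
    (hw : w ∈ admissible I u) {M : ℝ} (hM : ∀ t ∈ I, ∀ x, |u t x| ≤ M) (x y : Rn n) :
    |pvDensity s I u t₀ w (x, y)| ≤ 2 * M * (2 * M) / ‖x - y‖ ^ ((n : ℝ) + 2 * s) := by
  have hM0 : 0 ≤ M := (abs_nonneg _).trans (hM t₀ ht₀ 0)
  have hb : ∀ θ, ‖(w x - u t₀ x) * leafKernel s I u t₀ w x θ y‖ ≤
      2 * M * (2 * M) / ‖x - y‖ ^ ((n : ℝ) + 2 * s) := by
    intro θ
    rw [norm_mul, mul_div_assoc]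
    have h1 := abs_le.1 (abs_admissible_le hM hw x)
    have h2 := abs_le.1 (hM _ ht₀ x)
    refine mul_le_mul ?_ (abs_leafKernel_le hI hu ht₀ hw hM x θ y) (norm_nonneg _) (by positivity)
    rw [Real.norm_eq_abs, abs_le]
    constructor <;> linarith
  rw [pvDensity_eq]
  have := norm_integral_le_of_norm_le_const (μ := unitMeasure) (Eventually.of_forall hb)
  simpa using this

/-- The exterior condition collapses the interval of integration in λ. Hence integrals over Q(Ω)
reduce to Ω × ℝⁿ, where the first factor has finite measure. -/
theorem pvDensity_eq_zero {s : ℝ} {Ω : Set (Rn n)} (hD : SameDirichlet Ω w (u t₀))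
    {x : Rn n} (hx : x ∉ Ω) (y : Rn n) : pvDensity s I u t₀ w (x, y) = 0 := by
  rw [pvDensity, hD x hx, intervalIntegral.integral_same]

theorem measurableSet_QSet {Ω : Set (Rn n)} (hΩo : IsOpen Ω) : MeasurableSet (QSet Ω) :=
  (hΩo.measurableSet.compl.prod hΩo.measurableSet.compl).compl

theorem measurableSet_le_norm_sub (ε : ℝ) :
    MeasurableSet {p : Rn n × Rn n | ε ≤ ‖p.1 - p.2‖} :=
  measurableSet_le measurable_const (by fun_prop)

theorem restrict_prod_univ (Ω : Set (Rn n)) :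
    (volume : Measure (Rn n × Rn n)).restrict (Ω ×ˢ univ) =
      (volume.restrict Ω).prod volume := by
  rw [Measure.volume_eq_prod, ← Measure.prod_restrict, Measure.restrict_univ]

theorem integrable_indicator_pvDensity (hn : 1 ≤ n) {s : ℝ} (hs : s ∈ Ioo (0 : ℝ) 1)
    (hI : I.OrdConnected) (hu : IsField I u) (ht₀ : t₀ ∈ I) (hw : w ∈ admissible I u) {M : ℝ}
    (hM : ∀ t ∈ I, ∀ x, |u t x| ≤ M) {Ω : Set (Rn n)} (hΩ : Bornology.IsBounded Ω)
    {ε : ℝ} (hε : 0 < ε) :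
    Integrable ({p : Rn n × Rn n | ε ≤ ‖p.1 - p.2‖}.indicator (pvDensity s I u t₀ w))
      ((volume.restrict Ω).prod volume) := by
  have hM0 : 0 ≤ M := (abs_nonneg _).trans (hM t₀ ht₀ 0)
  have : IsFiniteMeasure (volume.restrict Ω) := isFiniteMeasure_restrict.2 hΩ.measure_lt_top.ne
  have hG := integrable_indicator_div_norm_rpow hn hs hε (by positivity : 0 ≤ 2 * M * (2 * M))
  have hGm : Measurable ({z : Rn n | ε ≤ ‖z‖}.indicator
      (fun z => 2 * M * (2 * M) / ‖z‖ ^ ((n : ℝ) + 2 * s))) :=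
    Measurable.indicator (by fun_prop) (measurableSet_le_norm ε)
  refine (integrable_comp_sub_prod hGm hG).mono'
    ((measurable_pvDensity s hI hu ht₀ hw).indicator
      (measurableSet_le_norm_sub ε)).aestronglyMeasurable (Eventually.of_forall fun p => ?_)
  by_cases hp : ε ≤ ‖p.1 - p.2‖
  · rw [indicator_of_mem (by exact hp), indicator_of_mem (by exact hp)]
    exact abs_pvDensity_le hI hu ht₀ hw hM p.1 p.2
  · rw [indicator_of_notMem (by exact hp), indicator_of_notMem (by exact hp), norm_zero]

theorem integrableOn_pvDensity (hn : 1 ≤ n) {s : ℝ} (hs : s ∈ Ioo (0 : ℝ) 1)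
    (hI : I.OrdConnected) (hu : IsField I u) (ht₀ : t₀ ∈ I) (hw : w ∈ admissible I u) {M : ℝ}
    (hM : ∀ t ∈ I, ∀ x, |u t x| ≤ M) {Ω : Set (Rn n)} (hΩo : IsOpen Ω)
    (hΩ : Bornology.IsBounded Ω) (hD : SameDirichlet Ω w (u t₀)) {ε : ℝ} (hε : 0 < ε) :
    IntegrableOn (pvDensity s I u t₀ w) (QSet Ω ∩ {p | ε ≤ ‖p.1 - p.2‖}) := by
  have h := integrable_indicator_pvDensity hn hs hI hu ht₀ hw hM hΩ hε
  rw [← restrict_prod_univ, integrable_indicator_iff (measurableSet_le_norm_sub ε), IntegrableOn,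
    Measure.restrict_restrict (measurableSet_le_norm_sub ε)] at h
  refine IntegrableOn.of_forall_sdiff_eq_zero h
    ((measurableSet_QSet hΩo).inter
      (measurableSet_le_norm_sub ε)) ?_
  rintro ⟨x, y⟩ ⟨⟨-, hp⟩, hnot⟩
  exact pvDensity_eq_zero hD (fun hx => hnot ⟨hp, hx, mem_univ _⟩) y

theorem pvTrunc_eq_integral_prod {s : ℝ} {Ω : Set (Rn n)} (hΩo : IsOpen Ω)
    (hD : SameDirichlet Ω w (u t₀)) (ε : ℝ) :
    pvTrunc s Ω I u t₀ w ε =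
      ∫ p, {p : Rn n × Rn n | ε ≤ ‖p.1 - p.2‖}.indicator (pvDensity s I u t₀ w) p
        ∂((volume.restrict Ω).prod volume) := by
  have hE := measurableSet_le_norm_sub (n := n) ε
  rw [integral_indicator hE, ← restrict_prod_univ, Measure.restrict_restrict hE, pvTrunc]
  refine setIntegral_eq_of_subset_of_forall_sdiff_eq_zero
    ((measurableSet_QSet hΩo).inter hE) ?_ ?_
  · rintro ⟨x, y⟩ ⟨hp, hx, -⟩
    exact ⟨fun h => h.1 hx, hp⟩
  · rintro ⟨x, y⟩ ⟨⟨-, hp⟩, hnot⟩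
    exact pvDensity_eq_zero hD (fun hx => hnot ⟨hp, hx, mem_univ _⟩) y

/-- Off the strip |x - y| < ε the integrand is absolutely integrable in (y, θ). Swapping the
integrals leaves, for each θ, the truncated operator of one fixed leaf. -/
theorem integral_indicator_pvDensity (hn : 1 ≤ n) {c s : ℝ} (hs : s ∈ Ioo (0 : ℝ) 1)
    (hI : I.OrdConnected) (hu : IsField I u) (ht₀ : t₀ ∈ I) (hw : w ∈ admissible I u) {M : ℝ}
    (hM : ∀ t ∈ I, ∀ x, |u t x| ≤ M) {ε : ℝ} (hε : 0 < ε) (x : Rn n) :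
    c * ∫ y, {p : Rn n × Rn n | ε ≤ ‖p.1 - p.2‖}.indicator (pvDensity s I u t₀ w) (x, y) =
      ∫ θ, (w x - u t₀ x) * fracLaplacianTrunc c s ε (u (leafTime I u t₀ w x θ)) x
        ∂unitMeasure := by
  have hM0 : 0 ≤ M := (abs_nonneg _).trans (hM t₀ ht₀ 0)
  have hE : MeasurableSet {y : Rn n | ε ≤ ‖x - y‖} := measurableSet_le measurable_const (by fun_prop)
  have e1 : ∀ y, {p : Rn n × Rn n | ε ≤ ‖p.1 - p.2‖}.indicator (pvDensity s I u t₀ w) (x, y) =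
      ∫ θ, {y : Rn n | ε ≤ ‖x - y‖}.indicator
        (fun y => (w x - u t₀ x) * leafKernel s I u t₀ w x θ y) y ∂unitMeasure := by
    intro y
    by_cases hy : ε ≤ ‖x - y‖
    · rw [indicator_of_mem (by exact hy), pvDensity_eq]
      congr 1
      ext θ
      rw [indicator_of_mem (by exact hy)]
    · rw [indicator_of_notMem (by exact hy)]
      symm
      convert integral_zero ℝ ℝ with θ
      rw [indicator_of_notMem (by exact hy)]
  have hG := (integrable_indicator_div_norm_rpow hn hs hε
    (by positivity : 0 ≤ |w x - u t₀ x| * (2 * M))).comp_sub_left x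
  have hint : Integrable (Function.uncurry fun (y : Rn n) (θ : ℝ) =>
      {y : Rn n | ε ≤ ‖x - y‖}.indicator (fun y => (w x - u t₀ x) * leafKernel s I u t₀ w x θ y) y)
      (volume.prod unitMeasure) := by
    refine (hG.comp_fst unitMeasure).mono' ?_ (Eventually.of_forall fun q => ?_)
    · have h3 : Measurable fun q : Rn n × ℝ => leafKernel s I u t₀ w x q.2 q.1 :=
        (measurable_leafKernel s hI hu ht₀ hw).comp
          (f := fun q : Rn n × ℝ => ((x, q.2), q.1)) (by fun_prop)
      exact ((h3.const_mul (w x - u t₀ x)).indicator (measurable_fst hE)).aestronglyMeasurable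
    · by_cases hy : ε ≤ ‖x - q.1‖
      · rw [Function.uncurry, indicator_of_mem (by exact hy), indicator_of_mem (by exact hy),
          norm_mul, mul_div_assoc, Real.norm_eq_abs, Real.norm_eq_abs]
        gcongr
        exact abs_leafKernel_le hI hu ht₀ hw hM x q.2 q.1
      · rw [Function.uncurry, indicator_of_notMem (by exact hy), norm_zero,
          indicator_of_notMem (by exact hy)]
  simp only [e1]
  rw [integral_integral_swap hint, ← integral_const_mul]
  congr 1
  ext θ
  rw [integral_indicator hE, integral_const_mul, fracLaplacianTrunc]
  simp only [leafKernel]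
  ring

theorem measurable_fracLaplacianTrunc_leafTime (c s ε : ℝ) (hI : I.OrdConnected) (hu : IsField I u)
    (ht₀ : t₀ ∈ I) (hw : w ∈ admissible I u) :
    Measurable fun q : Rn n × ℝ =>
      fracLaplacianTrunc c s ε (u (leafTime I u t₀ w q.1 q.2)) q.1 := by
  have e : (fun q : Rn n × ℝ => fracLaplacianTrunc c s ε (u (leafTime I u t₀ w q.1 q.2)) q.1) =
      fun q => c * ∫ y, {p : (Rn n × ℝ) × Rn n | ε ≤ ‖p.1.1 - p.2‖}.indicator
        (fun p => leafKernel s I u t₀ w p.1.1 p.1.2 p.2) (q, y) := by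
    ext q
    rw [fracLaplacianTrunc, ← integral_indicator (measurableSet_le measurable_const (by fun_prop))]
    rfl
  rw [e]
  have hE : MeasurableSet {p : (Rn n × ℝ) × Rn n | ε ≤ ‖p.1.1 - p.2‖} :=
    measurableSet_le measurable_const (by fun_prop)
  have h := ((measurable_leafKernel s hI hu ht₀ hw).indicator hE).stronglyMeasurable
  exact (h.integral_prod_right' (ν := volume)).measurable.const_mul c

/-! ### The limit ε ↓ 0. -/

theorem IsC2Field.tendsto_fracLaplacianTrunc (hn : 1 ≤ n) (c : ℝ) {s : ℝ} (hs : s ∈ Ioo (0 : ℝ) 1)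
    (hI : I.OrdConnected) (hu : IsC2Field I u) {M : ℝ} (hM : ∀ t ∈ I, ∀ x, |u t x| ≤ M)
    {t : ℝ} (ht : t ∈ I) (x : Rn n) :
    Tendsto (fun ε => fracLaplacianTrunc c s ε (u t) x) (𝓝[>] 0)
      (𝓝 (fracLaplacian c s (u t) x)) := by
  obtain ⟨K, hK0, hK⟩ := hu.exists_secondDiff_bound hI hM (isCompact_singleton (x := (x, t)))
    (by simpa using ht)
  exact FracCalib.tendsto_fracLaplacianTrunc hn c hs (hu.continuous_leaf ht) (hM t ht) hK0
    (hK _ rfl)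

theorem ae_prod_unitMeasure_mem {Ω : Set (Rn n)} (hΩo : IsOpen Ω) :
    ∀ᵐ q ∂((volume.restrict Ω).prod unitMeasure), q.1 ∈ Ω :=
  (Measure.quasiMeasurePreserving_fst (μ := volume.restrict Ω) (ν := unitMeasure)).ae
    (ae_restrict_mem hΩo.measurableSet)

/-- The principal value is the integral of the fractional Laplacians of the leaves crossed
between `u^{t₀}` and `w`. -/
theorem tendsto_pvTrunc (hn : 1 ≤ n) {c s : ℝ} (hc : 0 < c) (hs : s ∈ Ioo (0 : ℝ) 1)
    (hI : I.OrdConnected) (hu : IsC2Field I u) (ht₀ : t₀ ∈ I) (hw : w ∈ admissible I u) {M : ℝ}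
    (hM : ∀ t ∈ I, ∀ x, |u t x| ≤ M) {Ω : Set (Rn n)} (hΩo : IsOpen Ω)
    (hΩ : Bornology.IsBounded Ω) (hD : SameDirichlet Ω w (u t₀)) :
    Integrable (fun q : Rn n × ℝ => (w q.1 - u t₀ q.1) *
      fracLaplacian c s (u (leafTime I u t₀ w q.1 q.2)) q.1)
      ((volume.restrict Ω).prod unitMeasure) ∧
    Tendsto (fun ε => c * pvTrunc s Ω I u t₀ w ε) (𝓝[>] 0)
      (𝓝 (∫ q, (w q.1 - u t₀ q.1) * fracLaplacian c s (u (leafTime I u t₀ w q.1 q.2)) q.1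
        ∂((volume.restrict Ω).prod unitMeasure))) := by
  have : IsFiniteMeasure (volume.restrict Ω) := isFiniteMeasure_restrict.2 hΩ.measure_lt_top.ne
  have hM0 : 0 ≤ M := (abs_nonneg _).trans (hM t₀ ht₀ 0)
  have huf := hu.toIsField
  obtain ⟨K, hK0, hK⟩ := exists_secondDiff_bound_leafTime hI hu hM ht₀ hw hΩ
  set B := c / 2 * ∫ z : Rn n, min (K * ‖z‖ ^ 2) (4 * M) / ‖z‖ ^ ((n : ℝ) + 2 * s)
  have haeΩ := ae_prod_unitMeasure_mem hΩo
  have hmeas : ∀ ε, AEStronglyMeasurable (fun q : Rn n × ℝ => (w q.1 - u t₀ q.1) *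
      fracLaplacianTrunc c s ε (u (leafTime I u t₀ w q.1 q.2)) q.1)
      ((volume.restrict Ω).prod unitMeasure) := by
    intro ε
    have h1 := hw.1.measurable
    have h2 := (huf.continuous_leaf ht₀).measurable
    have h3 := measurable_fracLaplacianTrunc_leafTime c s ε hI huf ht₀ hw
    exact Measurable.aestronglyMeasurable (by fun_prop)
  have hdiff : ∀ x, |w x - u t₀ x| ≤ 2 * M := fun x => by
    have h1 := abs_le.1 (abs_admissible_le hM hw x)
    have h2 := abs_le.1 (hM _ ht₀ x)
    rw [abs_le]
    constructor <;> linarith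
  have hbound : ∀ ε > 0, ∀ᵐ q ∂((volume.restrict Ω).prod unitMeasure),
      ‖(w q.1 - u t₀ q.1) * fracLaplacianTrunc c s ε (u (leafTime I u t₀ w q.1 q.2)) q.1‖ ≤
        2 * M * B := by
    intro ε hε
    filter_upwards [haeΩ] with q hq
    have ht := leafTime_mem hI huf ht₀ hw q.1 q.2
    rw [norm_mul]
    exact mul_le_mul (hdiff q.1) (abs_fracLaplacianTrunc_le hn hc hs hε (huf.continuous_leaf ht)
      (hM _ ht) hK0 (hK q.1 hq q.2)) (norm_nonneg _) (by positivity)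
  have hlim : ∀ q : Rn n × ℝ, Tendsto (fun ε => (w q.1 - u t₀ q.1) *
      fracLaplacianTrunc c s ε (u (leafTime I u t₀ w q.1 q.2)) q.1) (𝓝[>] 0)
      (𝓝 ((w q.1 - u t₀ q.1) * fracLaplacian c s (u (leafTime I u t₀ w q.1 q.2)) q.1)) :=
    fun q => (hu.tendsto_fracLaplacianTrunc hn c hs hI hM
      (leafTime_mem hI huf ht₀ hw q.1 q.2) q.1).const_mul _
  refine ⟨?_, ?_⟩
  · refine Integrable.mono' (integrable_const (2 * M * B))
      -- The principal value inherits measurability in (x, θ) as a pointwise limit of the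
      -- truncations.
      (aestronglyMeasurable_of_tendsto_ae (𝓝[>] (0 : ℝ)) hmeas (Eventually.of_forall hlim)) ?_
    filter_upwards [haeΩ] with q hq
    have ht := leafTime_mem hI huf ht₀ hw q.1 q.2
    refine le_of_tendsto (hlim q).norm ?_
    filter_upwards [self_mem_nhdsWithin] with ε hε
    rw [norm_mul]
    exact mul_le_mul (hdiff q.1) (abs_fracLaplacianTrunc_le hn hc hs hε (huf.continuous_leaf ht)
      (hM _ ht) hK0 (hK q.1 hq q.2)) (norm_nonneg _) (by positivity)
  · have h := tendsto_integral_filter_of_dominated_convergence (l := 𝓝[>] (0 : ℝ))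
      (fun _ => 2 * M * B) (Eventually.of_forall hmeas)
      (eventually_nhdsWithin_of_forall hbound) (integrable_const _) (Eventually.of_forall hlim)
    refine h.congr' ?_
    filter_upwards [self_mem_nhdsWithin] with ε hε
    rw [pvTrunc_eq_integral_prod hΩo hD,
      integral_prod _ (integrable_indicator_pvDensity hn hs hI huf ht₀ hw hM hΩ hε),
      integral_prod _ ((integrable_const (2 * M * B)).mono' (hmeas ε) (hbound ε hε)),
      ← integral_const_mul]
    congr 1
    ext x
    exact (integral_indicator_pvDensity hn hs hI huf ht₀ hw hM hε x).symm

/-! ### The pointwise inequality for the symmetrized density. -/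

/-- The derivative is taken within the closed interval because its ends may be ends of `I`. The case
a = b is separate: a singleton has no unique derivatives. -/
theorem integral_comp_mul_derivWithin {f g : ℝ → ℝ} {a b : ℝ} (hf : ContDiffOn ℝ 1 f (uIcc a b))
    (hg : ContinuousOn g (f '' uIcc a b)) :
    ∫ t in a..b, g (f t) * derivWithin f (uIcc a b) t = ∫ l in f a..f b, g l := by
  rcases eq_or_ne a b with rfl | hab
  · simp
  have hU : UniqueDiffOn ℝ (uIcc a b) := by
    rw [uIcc]
    exact uniqueDiffOn_Icc (by simpa using hab.symm)
  refine intervalIntegral.integral_comp_mul_deriv'' (f := f) (g := g) hf.continuousOn ?_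
    (hf.continuousOn_derivWithin hU le_rfl) hg
  intro x hx
  have hn : uIcc a b ∈ 𝓝 x := Icc_mem_nhds hx.1 hx.2
  exact ((hf.differentiableOn one_ne_zero x (mem_of_mem_nhds hn)).hasDerivWithinAt.hasDerivAt
    hn).hasDerivWithinAt

theorem continuousOn_sub_leafParam (hI : I.OrdConnected) (hu : IsField I u) (x y : Rn n) :
    ContinuousOn (fun l => l - u (leafParam I u x l) y) {l | (x, l) ∈ foliatedRegion I u} := by
  have h1 : ContinuousOn (fun l => leafParam I u x l) {l | (x, l) ∈ foliatedRegion I u} :=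
    (hu.continuousOn_leafParam hI).comp (f := fun l : ℝ => (x, l)) (by fun_prop) fun _ hl => hl
  exact continuousOn_id.sub ((hu.contDiffOn_param y).continuousOn.comp h1
    fun l hl => leafParam_mem x hl)

theorem IsField.mem_foliatedRegion_of_mem_uIcc_apply (hI : I.OrdConnected) (hu : IsField I u)
    {a b : ℝ} (ha : a ∈ I) (hb : b ∈ I) (x : Rn n) {l : ℝ} (hl : l ∈ uIcc (u a x) (u b x)) :
    (x, l) ∈ foliatedRegion I u :=
  hu.mem_foliatedRegion_of_mem_uIcc hI ⟨a, ha, rfl⟩ ⟨b, hb, rfl⟩ hl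

theorem intervalIntegrable_sub_leafParam (hI : I.OrdConnected) (hu : IsField I u)
    {a b : ℝ} (ha : a ∈ I) (hb : b ∈ I) (x y : Rn n) :
    IntervalIntegrable (fun l => l - u (leafParam I u x l) y) volume (u a x) (u b x) :=
  ((continuousOn_sub_leafParam hI hu x y).mono fun _ hl =>
    hu.mem_foliatedRegion_of_mem_uIcc_apply hI ha hb x hl).intervalIntegrable

/-- Under the substitution l = u^t(x) the leaf parameter is `t` itself. -/
theorem integral_sub_leafParam_eq (hI : I.OrdConnected) (hu : IsField I u)
    {a b : ℝ} (ha : a ∈ I) (hb : b ∈ I) (x y : Rn n) :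
    ∫ l in (u a x)..(u b x), (l - u (leafParam I u x l) y) =
      ∫ t in a..b, (u t x - u t y) * derivWithin (fun t => u t x) (uIcc a b) t := by
  have hsub : uIcc a b ⊆ I := hI.uIcc_subset ha hb
  rw [← integral_comp_mul_derivWithin (f := fun t => u t x)
    (g := fun l => l - u (leafParam I u x l) y) ((hu.contDiffOn_param x).mono hsub)]
  · refine intervalIntegral.integral_congr fun t ht => ?_
    simp only [leafParam_unique hu (hsub ht)]
  · refine (continuousOn_sub_leafParam hI hu x y).mono ?_
    rintro _ ⟨t, ht, rfl⟩
    exact ⟨t, hsub ht, rfl⟩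

theorem intervalIntegrable_sub_mul_derivWithin (hI : I.OrdConnected) (hu : IsField I u)
    {a b : ℝ} (ha : a ∈ I) (hb : b ∈ I) (hab : a ≠ b) (x y z : Rn n) :
    IntervalIntegrable (fun t => (u t x - u t y) * derivWithin (fun t => u t z) (uIcc a b) t)
      volume a b := by
  have hsub : uIcc a b ⊆ I := hI.uIcc_subset ha hb
  have hU : UniqueDiffOn ℝ (uIcc a b) := by
    rw [uIcc]
    exact uniqueDiffOn_Icc (by simpa using hab.symm)
  refine ContinuousOn.intervalIntegrable (ContinuousOn.mul (ContinuousOn.sub ?_ ?_) ?_)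
  · exact (hu.contDiffOn_param x).continuousOn.mono hsub
  · exact (hu.contDiffOn_param y).continuousOn.mono hsub
  · exact ((hu.contDiffOn_param z).mono hsub).continuousOn_derivWithin hU le_rfl

/-- Between two leaves the symmetrized density is an exact difference of squares. -/
theorem integral_sub_leafParam_add (hI : I.OrdConnected) (hu : IsField I u)
    {a b : ℝ} (ha : a ∈ I) (hb : b ∈ I) (x y : Rn n) :
    (∫ l in (u a x)..(u b x), (l - u (leafParam I u x l) y)) +
      ∫ l in (u a y)..(u b y), (l - u (leafParam I u y l) x) =
    ((u b x - u b y) ^ 2 - (u a x - u a y) ^ 2) / 2 := by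
  rcases eq_or_ne a b with rfl | hab
  · simp
  have hsub : uIcc a b ⊆ I := hI.uIcc_subset ha hb
  have hx := (hu.contDiffOn_param x).mono hsub
  have hy := (hu.contDiffOn_param y).mono hsub
  rw [integral_sub_leafParam_eq hI hu ha hb x y, integral_sub_leafParam_eq hI hu ha hb y x,
    ← intervalIntegral.integral_add (intervalIntegrable_sub_mul_derivWithin hI hu ha hb hab x y x)
      (intervalIntegrable_sub_mul_derivWithin hI hu ha hb hab y x y)]
  -- Summed, the two integrands are g g' with g(t) = u^t(x) - u^t(y), hence the exact derivative of
  -- g²/2.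
  have h := integral_comp_mul_derivWithin (f := fun t => u t x - u t y) (g := fun l => l)
    (hx.sub hy) continuousOn_id
  rw [integral_id] at h
  rw [← h]
  refine intervalIntegral.integral_congr fun t ht => ?_
  have e : derivWithin (fun t => u t x - u t y) (uIcc a b) t =
      derivWithin (fun t => u t x) (uIcc a b) t - derivWithin (fun t => u t y) (uIcc a b) t :=
    derivWithin_fun_sub (hx.differentiableOn one_ne_zero t ht)
      (hy.differentiableOn one_ne_zero t ht)
  rw [e]
  ring

/-- Heights above u^a(x) lie on leaves t ≥ a, whose values at `y` are at least u^a(y). Freezing the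
leaf value at `y` therefore only increases the integrand. -/
theorem integral_sub_leafParam_le (hI : I.OrdConnected) (hu : IsField I u)
    {a b : ℝ} (ha : a ∈ I) (hb : b ∈ I) (hab : a ≤ b) (x y : Rn n) :
    ∫ l in (u a x)..(u b x), (l - u (leafParam I u x l) y) ≤
      ((u b x - u a y) ^ 2 - (u a x - u a y) ^ 2) / 2 := by
  have hle : u a x ≤ u b x := (hu.strictMonoOn_param x).monotoneOn ha hb hab
  calc ∫ l in (u a x)..(u b x), (l - u (leafParam I u x l) y)
      ≤ ∫ l in (u a x)..(u b x), (l - u a y) := by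
        refine intervalIntegral.integral_mono_on hle
          (intervalIntegrable_sub_leafParam hI hu ha hb x y)
          (Continuous.intervalIntegrable (by fun_prop) _ _) fun l hl => ?_
        have hmem := hu.mem_foliatedRegion_of_mem_uIcc_apply hI ha hb x (Icc_subset_uIcc hl)
        have h1 : a ≤ leafParam I u x l := by
          by_contra! h
          exact absurd ((hu.leafParam_lt_iff ha hmem).1 h) (not_lt.2 hl.1)
        exact sub_le_sub_left
          ((hu.strictMonoOn_param y).monotoneOn ha (leafParam_mem x hmem) h1) l
    _ = _ := by
        rw [intervalIntegral.integral_sub intervalIntegral.intervalIntegrable_id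
          intervalIntegrable_const, integral_id, intervalIntegral.integral_const, smul_eq_mul]
        ring

/-- A Young-type inequality for the two monotone functions `t ↦ u^t(x)`, `t ↦ u^t(y)`. -/
theorem integral_sub_leafParam_add_le (hI : I.OrdConnected) (hu : IsField I u)
    {a b b' : ℝ} (ha : a ∈ I) (hb : b ∈ I) (hb' : b' ∈ I) (x y : Rn n) :
    (∫ l in (u a x)..(u b x), (l - u (leafParam I u x l) y)) +
      ∫ l in (u a y)..(u b' y), (l - u (leafParam I u y l) x) ≤
    ((u b x - u b' y) ^ 2 - (u a x - u a y) ^ 2) / 2 := by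
  -- By symmetry `x` goes at least as far as `y`. Up to the common leaf `b'` there is equality;
  -- beyond it only `x` moves and the one-sided bound applies.
  wlog h : b' ≤ b generalizing b b' x y
  · have := this hb' hb y x (le_of_not_ge h)
    rw [add_comm, sub_sq_comm (u b x), sub_sq_comm (u a x)]
    exact this
  rw [← intervalIntegral.integral_add_adjacent_intervals
    (intervalIntegrable_sub_leafParam hI hu ha hb' x y)
    (intervalIntegrable_sub_leafParam hI hu hb' hb x y)]
  linarith [integral_sub_leafParam_add hI hu ha hb' x y, integral_sub_leafParam_le hI hu hb' hb h x y]

theorem leafQuotient_eq (s : ℝ) (hI : I.OrdConnected) (hu : IsField I u) {a b : ℝ} (ha : a ∈ I)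
    (hb : b ∈ I) (x y : Rn n) {l : ℝ} (hl : l ∈ uIcc (u a x) (u b x)) :
    leafQuotient s I u x y l =
      (l - u (leafParam I u x l) y) / ‖x - y‖ ^ ((n : ℝ) + 2 * s) := by
  rw [leafQuotient, apply_leafParam x (hu.mem_foliatedRegion_of_mem_uIcc_apply hI ha hb x hl)]

theorem intervalIntegrable_leafQuotient (s : ℝ) (hI : I.OrdConnected) (hu : IsField I u)
    (ht₀ : t₀ ∈ I) (hw : w ∈ admissible I u) (x y : Rn n) :
    IntervalIntegrable (leafQuotient s I u x y) volume (u t₀ x) (w x) := by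
  obtain ⟨T, hT, e⟩ := hw.2.2 x
  dsimp only at e
  rw [e]
  refine ((intervalIntegrable_sub_leafParam hI hu ht₀ hT x y).div_const
    (‖x - y‖ ^ ((n : ℝ) + 2 * s))).congr ?_
  intro l hl
  exact (leafQuotient_eq s hI hu ht₀ hT x y (uIoc_subset_uIcc hl)).symm

/-! ### Comparison with the Gagliardo energy. -/

/-- The integrand `|w(x) - w(y)|² / |x - y|^{n+2s}` of the seminorm. -/
def gagliardo (s : ℝ) (w : Rn n → ℝ) (p : Rn n × Rn n) : ℝ :=
  |w p.1 - w p.2| ^ 2 / ‖p.1 - p.2‖ ^ ((n : ℝ) + 2 * s)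

theorem gagliardo_nonneg (s : ℝ) (w : Rn n → ℝ) (p : Rn n × Rn n) : 0 ≤ gagliardo s w p := by
  unfold gagliardo
  positivity

theorem measurable_gagliardo (s : ℝ) {w : Rn n → ℝ} (hw : Continuous w) :
    Measurable (gagliardo s w) := by
  have h : Continuous fun p : Rn n × Rn n => |w p.1 - w p.2| ^ 2 := by fun_prop
  exact h.measurable.div (by fun_prop)

theorem gagliardo_swap (s : ℝ) (w : Rn n → ℝ) (p : Rn n × Rn n) :
    gagliardo s w p.swap = gagliardo s w p := by
  rw [gagliardo, gagliardo, Prod.fst_swap, Prod.snd_swap, abs_sub_comm, norm_sub_rev]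

theorem pvDensity_add_swap_le (s : ℝ) (hI : I.OrdConnected) (hu : IsField I u)
    (ht₀ : t₀ ∈ I) (hw : w ∈ admissible I u) (p : Rn n × Rn n) :
    pvDensity s I u t₀ w p + pvDensity s I u t₀ w p.swap ≤
      (gagliardo s w p - gagliardo s (u t₀) p) / 2 := by
  obtain ⟨x, y⟩ := p
  obtain ⟨T, hT, e⟩ := hw.2.2 x
  obtain ⟨S, hS, e'⟩ := hw.2.2 y
  dsimp only at e e'
  have h1 : pvDensity s I u t₀ w (x, y) = (∫ l in (u t₀ x)..(u T x),
      (l - u (leafParam I u x l) y)) / ‖x - y‖ ^ ((n : ℝ) + 2 * s) := by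
    rw [pvDensity, ← intervalIntegral.integral_div, ← e]
    refine intervalIntegral.integral_congr fun l hl => ?_
    exact leafQuotient_eq s hI hu ht₀ hT x y (e ▸ hl)
  have h2 : pvDensity s I u t₀ w (y, x) = (∫ l in (u t₀ y)..(u S y),
      (l - u (leafParam I u y l) x)) / ‖x - y‖ ^ ((n : ℝ) + 2 * s) := by
    rw [pvDensity, ← intervalIntegral.integral_div, ← e', norm_sub_rev x y]
    refine intervalIntegral.integral_congr fun l hl => ?_
    exact leafQuotient_eq s hI hu ht₀ hS y x (e' ▸ hl)
  rw [Prod.swap_prod_mk, h1, h2, gagliardo, gagliardo, sq_abs, sq_abs, ← add_div, ← sub_div,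
    div_right_comm]
  dsimp only
  rw [e, e']
  gcongr
  exact integral_sub_leafParam_add_le hI hu ht₀ hT hS x y

theorem swap_preimage_QSet (Ω : Set (Rn n)) : Prod.swap ⁻¹' QSet Ω = QSet Ω := by
  ext p
  simp only [QSet, mem_preimage, mem_compl_iff, mem_prod, Prod.fst_swap, Prod.snd_swap]
  tauto

theorem swap_preimage_truncated (Ω : Set (Rn n)) (ε : ℝ) :
    Prod.swap ⁻¹' (QSet Ω ∩ {p : Rn n × Rn n | ε ≤ ‖p.1 - p.2‖}) =
      QSet Ω ∩ {p | ε ≤ ‖p.1 - p.2‖} := by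
  rw [preimage_inter, swap_preimage_QSet]
  congr 1
  ext p
  simp [norm_sub_rev]

theorem measurePreserving_swap_Rn :
    MeasurePreserving (Prod.swap : Rn n × Rn n → Rn n × Rn n) volume volume := by
  rw [Measure.volume_eq_prod]
  exact Measure.measurePreserving_swap

theorem pvTrunc_le (hn : 1 ≤ n) {s : ℝ} (hs : s ∈ Ioo (0 : ℝ) 1)
    (hI : I.OrdConnected) (hu : IsField I u) (ht₀ : t₀ ∈ I) (hw : w ∈ admissible I u) {M : ℝ}
    (hM : ∀ t ∈ I, ∀ x, |u t x| ≤ M) {Ω : Set (Rn n)} (hΩo : IsOpen Ω)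
    (hΩ : Bornology.IsBounded Ω) (hD : SameDirichlet Ω w (u t₀))
    (h₁ : IntegrableOn (gagliardo s w) (QSet Ω)) (h₀ : IntegrableOn (gagliardo s (u t₀)) (QSet Ω))
    {ε : ℝ} (hε : 0 < ε) :
    pvTrunc s Ω I u t₀ w ε + (∫ p in QSet Ω ∩ {p | ε ≤ ‖p.1 - p.2‖}, gagliardo s (u t₀) p) / 4 ≤
      (∫ p in QSet Ω, gagliardo s w p) / 4 := by
  set Q := QSet Ω ∩ {p : Rn n × Rn n | ε ≤ ‖p.1 - p.2‖} with hQ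
  have hemb : MeasurableEmbedding (Prod.swap : Rn n × Rn n → Rn n × Rn n) :=
    MeasurableEquiv.prodComm.measurableEmbedding
  have hi := integrableOn_pvDensity hn hs hI hu ht₀ hw hM hΩo hΩ hD hε
  have hi' : IntegrableOn (fun p => pvDensity s I u t₀ w p.swap) Q := by
    have := (measurePreserving_swap_Rn.integrableOn_comp_preimage hemb).2 hi
    rwa [swap_preimage_truncated] at this
  have hswap : ∫ p in Q, pvDensity s I u t₀ w p.swap = pvTrunc s Ω I u t₀ w ε := by
    have := measurePreserving_swap_Rn.setIntegral_preimage_emb hemb (pvDensity s I u t₀ w) Q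
    rwa [hQ, swap_preimage_truncated] at this
  have h₁' := h₁.mono_set (inter_subset_left : Q ⊆ QSet Ω)
  have h₀' := h₀.mono_set (inter_subset_left : Q ⊆ QSet Ω)
  -- The domain is symmetric under the swap, so the left side is twice the truncated integral; with
  -- the factor 1/2 on the right this produces c/4 in the energy.
  have key : ∫ p in Q, (pvDensity s I u t₀ w p + pvDensity s I u t₀ w p.swap) ≤
      ∫ p in Q, (gagliardo s w p - gagliardo s (u t₀) p) / 2 :=
    integral_mono (hi.add hi') ((h₁'.sub h₀').div_const 2)
      fun p => pvDensity_add_swap_le s hI hu ht₀ hw p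
  rw [integral_add hi hi', hswap, integral_div, integral_sub h₁' h₀'] at key
  -- Only the competitor's term may be enlarged to all of Q(Ω). The base leaf's term has the
  -- opposite sign and stays truncated until the limit.
  have hmono : ∫ p in Q, gagliardo s w p ≤ ∫ p in QSet Ω, gagliardo s w p :=
    setIntegral_mono_set h₁ (Eventually.of_forall fun p => gagliardo_nonneg s w p)
      inter_subset_left.eventuallyLE
  have e : ∫ p in Q, pvDensity s I u t₀ w p = pvTrunc s Ω I u t₀ w ε := rfl
  linarith

theorem tendsto_setIntegral_gagliardo {s : ℝ} {v : Rn n → ℝ} {Ω : Set (Rn n)}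
    (h : IntegrableOn (gagliardo s v) (QSet Ω)) :
    Tendsto (fun ε : ℝ => ∫ p in QSet Ω ∩ {p | ε ≤ ‖p.1 - p.2‖}, gagliardo s v p) (𝓝[>] 0)
      (𝓝 (∫ p in QSet Ω, gagliardo s v p)) := by
  have hlim : Tendsto (fun ε : ℝ => ∫ p in QSet Ω,
      {p : Rn n × Rn n | ε ≤ ‖p.1 - p.2‖}.indicator (gagliardo s v) p) (𝓝[>] 0)
      (𝓝 (∫ p in QSet Ω, gagliardo s v p)) := by
    refine tendsto_integral_filter_of_dominated_convergence (fun p => ‖gagliardo s v p‖)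
      (Eventually.of_forall fun ε =>
        h.aestronglyMeasurable.indicator (measurableSet_le_norm_sub ε))
      (Eventually.of_forall fun ε => Eventually.of_forall fun p => norm_indicator_le_norm_self _ p)
      h.norm (Eventually.of_forall fun p => ?_)
    refine tendsto_const_nhds.congr' ?_
    rcases eq_or_ne (p.1 - p.2) 0 with hz | hz
    · refine Eventually.of_forall fun ε => ?_
      have : gagliardo s v p = 0 := by simp [gagliardo, sub_eq_zero.1 hz]
      simp only [indicator, this, ite_self]
    · have : Iio ‖p.1 - p.2‖ ∈ 𝓝[>] (0 : ℝ) :=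
        mem_nhdsWithin_of_mem_nhds (Iio_mem_nhds (norm_pos_iff.2 hz))
      filter_upwards [this] with ε hε
      rw [indicator_of_mem]
      exact (mem_Iio.1 hε).le
  refine hlim.congr fun ε => ?_
  rw [integral_indicator (measurableSet_le_norm_sub ε),
    Measure.restrict_restrict (measurableSet_le_norm_sub ε), inter_comm]

theorem seminormEnergy_ne_top_iff {c s : ℝ} (hc : 0 < c) {w : Rn n → ℝ} (hw : Continuous w)
    (Ω : Set (Rn n)) :
    seminormEnergy c s Ω w ≠ ∞ ↔ IntegrableOn (gagliardo s w) (QSet Ω) := by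
  have h := lintegral_ofReal_ne_top_iff_integrable (μ := volume.restrict (QSet Ω))
    (measurable_gagliardo s hw).aestronglyMeasurable
    (Eventually.of_forall fun p => gagliardo_nonneg s w p)
  rw [IntegrableOn, ← h, seminormEnergy, Ne, Ne, ENNReal.mul_eq_top]
  have : 0 < c / 4 := by positivity
  simp [gagliardo, this]

theorem toReal_seminormEnergy {c s : ℝ} (hc : 0 < c) {w : Rn n → ℝ} (hw : Continuous w)
    (Ω : Set (Rn n)) :
    (seminormEnergy c s Ω w).toReal = c / 4 * ∫ p in QSet Ω, gagliardo s w p := by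
  rw [integral_eq_lintegral_of_nonneg_ae (Eventually.of_forall fun p => gagliardo_nonneg s w p)
    (measurable_gagliardo s hw).aestronglyMeasurable, seminormEnergy, ENNReal.toReal_mul,
    ENNReal.toReal_ofReal (by positivity)]
  rfl

theorem QSet_eq_union (Ω : Set (Rn n)) : QSet Ω = Ω ×ˢ univ ∪ Prod.swap ⁻¹' (Ω ×ˢ univ) := by
  ext p
  simp only [QSet, mem_compl_iff, mem_prod, mem_union, mem_preimage, Prod.fst_swap, mem_univ]
  tauto

/-- Over Ω × ℝⁿ the squared increment is at most the minimum of L²|x - y|² and (2M)², an integrable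
profile; swap symmetry covers the rest of Q(Ω). -/
theorem integrableOn_gagliardo_of_contDiff (hn : 1 ≤ n) {s : ℝ} (hs : s ∈ Ioo (0 : ℝ) 1)
    {v : Rn n → ℝ} (hv : ContDiff ℝ 1 v) {M : ℝ} (hM : ∀ x, |v x| ≤ M) {Ω : Set (Rn n)}
    (hΩo : IsOpen Ω) (hΩ : Bornology.IsBounded Ω) : IntegrableOn (gagliardo s v) (QSet Ω) := by
  have hM0 : 0 ≤ M := (abs_nonneg _).trans (hM 0)
  have : IsFiniteMeasure (volume.restrict Ω) := isFiniteMeasure_restrict.2 hΩ.measure_lt_top.ne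
  obtain ⟨L, hL0, hL⟩ := exists_lipschitz_bound hv hM hΩ.isCompact_closure
  have hG := integrable_min_sq_div_norm_rpow hn hs (K := L ^ 2) (A := (2 * M) ^ 2) (by positivity)
    (by positivity)
  have h1 : IntegrableOn (gagliardo s v) (Ω ×ˢ univ) := by
    have hGp := integrable_comp_sub_prod (μ := volume.restrict Ω) (by fun_prop) hG
    rw [← restrict_prod_univ] at hGp
    refine Integrable.mono' hGp (measurable_gagliardo s hv.continuous).aestronglyMeasurable
      ((ae_restrict_iff' (hΩo.measurableSet.prod MeasurableSet.univ)).2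
        (Eventually.of_forall fun p hp => ?_))
    rw [Real.norm_of_nonneg (gagliardo_nonneg s v p), gagliardo]
    gcongr
    refine le_min ?_ ?_
    · rw [← mul_pow]
      gcongr
      exact hL p.1 (subset_closure hp.1) p.2
    · gcongr
      have h1 := abs_le.1 (hM p.1)
      have h2 := abs_le.1 (hM p.2)
      rw [abs_le]
      constructor <;> linarith
  rw [QSet_eq_union]
  refine h1.union ?_
  have h2 := (measurePreserving_swap_Rn.integrableOn_comp_preimage
    MeasurableEquiv.prodComm.measurableEmbedding).2 h1
  exact h2.congr_fun (fun p _ => gagliardo_swap s v p)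
    (measurable_swap (hΩo.measurableSet.prod MeasurableSet.univ))

theorem integrableOn_comp_of_bounded {F : ℝ → ℝ} (hF : Continuous F) {w : Rn n → ℝ}
    (hw : Continuous w) {Ω : Set (Rn n)} (hΩ : Bornology.IsBounded Ω) :
    IntegrableOn (fun x => F (w x)) Ω :=
  ((hF.comp hw).continuousOn.integrableOn_compact hΩ.isCompact_closure).mono_set subset_closure

/-! ### The potential term. -/

/-- The increment of the potential energy, in terms of the leaves crossed. -/
theorem integral_potential_sub (hI : I.OrdConnected) (hu : IsField I u) (ht₀ : t₀ ∈ I)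
    (hw : w ∈ admissible I u) {M : ℝ} (hM : ∀ t ∈ I, ∀ x, |u t x| ≤ M) {Ω : Set (Rn n)}
    (hΩ : Bornology.IsBounded Ω) {F : ℝ → ℝ} (hF : ContDiff ℝ 1 F) :
    Integrable (fun q : Rn n × ℝ => (w q.1 - u t₀ q.1) *
      deriv F (u (leafTime I u t₀ w q.1 q.2) q.1)) ((volume.restrict Ω).prod unitMeasure) ∧
    (∫ x in Ω, F (w x)) - ∫ x in Ω, F (u t₀ x) =
      ∫ q, (w q.1 - u t₀ q.1) * deriv F (u (leafTime I u t₀ w q.1 q.2) q.1)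
        ∂((volume.restrict Ω).prod unitMeasure) := by
  have : IsFiniteMeasure (volume.restrict Ω) := isFiniteMeasure_restrict.2 hΩ.measure_lt_top.ne
  have hM0 : 0 ≤ M := (abs_nonneg _).trans (hM t₀ ht₀ 0)
  have hF' : Continuous (deriv F) := hF.continuous_deriv le_rfl
  -- All leaf values lie in [-M, M], so a bound for F' there suffices.
  obtain ⟨B, hB⟩ := (isCompact_Icc (a := -M) (b := M)).exists_bound_of_continuousOn
    hF'.continuousOn
  have hcont : Continuous fun q : Rn n × ℝ => (w q.1 - u t₀ q.1) *
      deriv F (u (leafTime I u t₀ w q.1 q.2) q.1) := by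
    simp only [apply_leafTime hI hu ht₀ hw]
    have h1 := continuous_leafLevel hu ht₀ hw
    have h2 := hw.1
    have h3 := hu.continuous_leaf ht₀
    fun_prop
  have hint : Integrable (fun q : Rn n × ℝ => (w q.1 - u t₀ q.1) *
      deriv F (u (leafTime I u t₀ w q.1 q.2) q.1)) ((volume.restrict Ω).prod unitMeasure) := by
    refine Integrable.mono' (integrable_const (2 * M * B)) hcont.aestronglyMeasurable
      (Eventually.of_forall fun q => ?_)
    rw [norm_mul]
    have h1 := abs_le.1 (abs_admissible_le hM hw q.1)
    have h2 := abs_le.1 (hM _ ht₀ q.1)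
    refine mul_le_mul ?_ (hB _ (abs_le.1 (hM _ (leafTime_mem hI hu ht₀ hw q.1 q.2) q.1)))
      (norm_nonneg _) (by positivity)
    rw [Real.norm_eq_abs, abs_le]
    constructor <;> linarith
  refine ⟨hint, ?_⟩
  rw [integral_prod _ hint, ← integral_sub (integrableOn_comp_of_bounded hF.continuous hw.1 hΩ)
    (integrableOn_comp_of_bounded hF.continuous (hu.continuous_leaf ht₀) hΩ)]
  congr 1
  ext x
  have h := intervalIntegral.mul_integral_comp_add_mul (a := 0) (b := 1)
    (f := deriv F) (w x - u t₀ x) (u t₀ x)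
  rw [mul_zero, add_zero, mul_one, add_sub_cancel, intervalIntegral.integral_deriv_eq_sub
    (fun y _ => (hF.differentiable one_ne_zero) y) (hF'.intervalIntegrable _ _),
    intervalIntegral.integral_of_le zero_le_one, ← integral_const_mul] at h
  rw [← h]
  refine setIntegral_congr_fun measurableSet_Ioc fun θ hθ => ?_
  simp only [apply_leafTime hI hu ht₀ hw, leafLevel_of_mem ⟨hθ.1.le, hθ.2⟩]

/-! ### The calibration properties and minimality. -/

theorem leaf_mem_admissible (hu : IsField I u) {M : ℝ} (hM : ∀ t ∈ I, ∀ x, |u t x| ≤ M)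
    (ht₀ : t₀ ∈ I) : u t₀ ∈ admissible I u :=
  ⟨hu.continuous_leaf ht₀, ⟨M, hM t₀ ht₀⟩, fun _ => ⟨t₀, ht₀, rfl⟩⟩

theorem seminormEnergy_leaf_ne_top (hn : 1 ≤ n) {c s : ℝ} (hc : 0 < c) (hs : s ∈ Ioo (0 : ℝ) 1)
    (hu : IsC2Field I u) (ht₀ : t₀ ∈ I) {M : ℝ} (hM : ∀ t ∈ I, ∀ x, |u t x| ≤ M)
    {Ω : Set (Rn n)} (hΩo : IsOpen Ω) (hΩ : Bornology.IsBounded Ω) :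
    seminormEnergy c s Ω (u t₀) ≠ ∞ :=
  (seminormEnergy_ne_top_iff hc (hu.continuous_leaf ht₀) Ω).2
    (integrableOn_gagliardo_of_contDiff hn hs ((hu.contDiff_leaf ht₀).of_le one_le_two)
      (hM t₀ ht₀) hΩo hΩ)

theorem tendsto_pvTrunc_pvIntegral (hn : 1 ≤ n) {s : ℝ} (hs : s ∈ Ioo (0 : ℝ) 1)
    (hI : I.OrdConnected) (hu : IsC2Field I u) (ht₀ : t₀ ∈ I) (hw : w ∈ admissible I u) {M : ℝ}
    (hM : ∀ t ∈ I, ∀ x, |u t x| ≤ M) {Ω : Set (Rn n)} (hΩo : IsOpen Ω)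
    (hΩ : Bornology.IsBounded Ω) (hD : SameDirichlet Ω w (u t₀)) :
    Tendsto (pvTrunc s Ω I u t₀ w) (𝓝[>] 0) (𝓝 (pvIntegral s Ω I u t₀ w)) := by
  -- Taking the constant c = 1 gives the limit of the bare truncated integrals.
  have h := (tendsto_pvTrunc hn one_pos hs hI hu ht₀ hw hM hΩo hΩ hD).2
  simp only [one_mul] at h
  exact tendsto_nhds_limUnder ⟨_, h⟩

theorem wellDefinedAt (hn : 1 ≤ n) {c s : ℝ} (hc : 0 < c) (hs : s ∈ Ioo (0 : ℝ) 1)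
    (hI : I.OrdConnected) (hu : IsC2Field I u) (ht₀ : t₀ ∈ I) (hw : w ∈ admissible I u) {M : ℝ}
    (hM : ∀ t ∈ I, ∀ x, |u t x| ≤ M) {Ω : Set (Rn n)} (hΩo : IsOpen Ω)
    (hΩ : Bornology.IsBounded Ω) (hD : SameDirichlet Ω w (u t₀)) {F : ℝ → ℝ}
    (hF : Continuous F) : WellDefinedAt c s Ω I u t₀ F w where
  inner := intervalIntegrable_leafQuotient s hI hu.toIsField ht₀ hw
  outer _ hε := integrableOn_pvDensity hn hs hI hu.toIsField ht₀ hw hM hΩo hΩ hD hε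
  limit := tendsto_pvTrunc_pvIntegral hn hs hI hu ht₀ hw hM hΩo hΩ hD
  potential := integrableOn_comp_of_bounded hF hw.1 hΩ
  leaf := seminormEnergy_leaf_ne_top hn hc hs hu ht₀ hM hΩo hΩ

theorem calibration_leaf (c s : ℝ) (Ω : Set (Rn n)) (I : Set ℝ) (u : ℝ → Rn n → ℝ) (t₀ : ℝ)
    (F : ℝ → ℝ) :
    calibration c s Ω I u t₀ F (u t₀) =
      -(∫ x in Ω, F (u t₀ x)) + (seminormEnergy c s Ω (u t₀)).toReal := by
  have h : pvTrunc s Ω I u t₀ (u t₀) = fun _ => 0 := by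
    ext ε
    simp [pvTrunc, pvDensity]
  have h' : pvIntegral s Ω I u t₀ (u t₀) = 0 := by
    rw [pvIntegral, h]
    exact tendsto_const_nhds.limUnder_eq
  rw [calibration, h']
  ring

/-- The calibration functional in terms of the Euler-Lagrange expressions of the leaves crossed
between `u^{t₀}` and `w`. -/
theorem calibration_eq (hn : 1 ≤ n) {c s : ℝ} (hc : 0 < c) (hs : s ∈ Ioo (0 : ℝ) 1)
    (hI : I.OrdConnected) (hu : IsC2Field I u) (ht₀ : t₀ ∈ I) (hw : w ∈ admissible I u) {M : ℝ}
    (hM : ∀ t ∈ I, ∀ x, |u t x| ≤ M) {Ω : Set (Rn n)} (hΩo : IsOpen Ω)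
    (hΩ : Bornology.IsBounded Ω) (hD : SameDirichlet Ω w (u t₀)) {F : ℝ → ℝ}
    (hF : ContDiff ℝ 1 F) :
    calibration c s Ω I u t₀ F w = calibration c s Ω I u t₀ F (u t₀) +
      ∫ q, (w q.1 - u t₀ q.1) * (fracLaplacian c s (u (leafTime I u t₀ w q.1 q.2)) q.1 -
        deriv F (u (leafTime I u t₀ w q.1 q.2) q.1))
        ∂((volume.restrict Ω).prod unitMeasure) := by
  obtain ⟨hi, hlim⟩ := tendsto_pvTrunc hn hc hs hI hu ht₀ hw hM hΩo hΩ hD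
  obtain ⟨hi', hpot⟩ := integral_potential_sub hI hu.toIsField ht₀ hw hM hΩ hF
  have hpv := tendsto_nhds_unique hlim
    ((tendsto_pvTrunc_pvIntegral hn hs hI hu ht₀ hw hM hΩo hΩ hD).const_mul c)
  simp only [mul_sub]
  rw [integral_sub hi hi', ← hpot, hpv, calibration_leaf, calibration]
  ring

theorem calibC1_leaf (hn : 1 ≤ n) {c s : ℝ} (hc : 0 < c) (hs : s ∈ Ioo (0 : ℝ) 1)
    (hu : IsC2Field I u) (ht₀ : t₀ ∈ I) {M : ℝ} (hM : ∀ t ∈ I, ∀ x, |u t x| ≤ M)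
    {Ω : Set (Rn n)} (hΩo : IsOpen Ω) (hΩ : Bornology.IsBounded Ω) (F : ℝ → ℝ) :
    CalibC1 (calibration c s Ω I u t₀ F) (energy c s Ω F) (u t₀) := by
  rw [CalibC1, energy, calibration_leaf, ← EReal.coe_ennreal_toReal
    (seminormEnergy_leaf_ne_top hn hc hs hu ht₀ hM hΩo hΩ), ← EReal.coe_sub]
  congr 1
  ring

theorem calibC2_leaf (hn : 1 ≤ n) {c s : ℝ} (hc : 0 < c) (hs : s ∈ Ioo (0 : ℝ) 1)
    (hI : I.OrdConnected) (hu : IsC2Field I u) (ht₀ : t₀ ∈ I) {M : ℝ}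
    (hM : ∀ t ∈ I, ∀ x, |u t x| ≤ M) {Ω : Set (Rn n)} (hΩo : IsOpen Ω)
    (hΩ : Bornology.IsBounded Ω) (F : ℝ → ℝ) :
    CalibC2 Ω (admissible I u) (calibration c s Ω I u t₀ F) (energy c s Ω F) (u t₀) := by
  intro w hw hD
  -- An infinite energy leaves nothing to prove. Otherwise the symmetrized inequality can be
  -- integrated with real values and passed to the limit.
  by_cases htop : seminormEnergy c s Ω w = ∞
  · rw [energy, htop, EReal.coe_ennreal_top, EReal.top_sub_coe]
    exact le_top
  have h₁ := (seminormEnergy_ne_top_iff hc hw.1 Ω).1 htop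
  have h₀ := (seminormEnergy_ne_top_iff hc (hu.continuous_leaf ht₀) Ω).1
    (seminormEnergy_leaf_ne_top hn hc hs hu ht₀ hM hΩo hΩ)
  have key : pvIntegral s Ω I u t₀ w + (∫ p in QSet Ω, gagliardo s (u t₀) p) / 4 ≤
      (∫ p in QSet Ω, gagliardo s w p) / 4 := by
    refine le_of_tendsto ((tendsto_pvTrunc_pvIntegral hn hs hI hu ht₀ hw hM hΩo hΩ hD).add
      ((tendsto_setIntegral_gagliardo h₀).div_const 4)) ?_
    filter_upwards [self_mem_nhdsWithin] with ε hε
    exact pvTrunc_le hn hs hI hu.toIsField ht₀ hw hM hΩo hΩ hD h₁ h₀ hε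
  rw [energy, ← EReal.coe_ennreal_toReal htop, ← EReal.coe_sub, EReal.coe_le_coe_iff, calibration,
    toReal_seminormEnergy hc hw.1, toReal_seminormEnergy hc (hu.continuous_leaf ht₀)]
  have := mul_le_mul_of_nonneg_left key hc.le
  linarith

theorem leafTime_le_of_le (hI : I.OrdConnected) (hu : IsField I u) (ht₀ : t₀ ∈ I)
    (hw : w ∈ admissible I u) {x : Rn n} (h : w x ≤ u t₀ x) (θ : ℝ) :
    leafTime I u t₀ w x θ ≤ t₀ := by
  by_contra! hlt
  have h1 := (hu.lt_leafParam_iff ht₀ (leafLevel_mem hI hu ht₀ hw x θ)).1 hlt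
  have h0 : (0 : ℝ) ≤ max 0 (min 1 θ) := le_max_left _ _
  rw [leafLevel] at h1
  nlinarith

theorem le_leafTime_of_le (hI : I.OrdConnected) (hu : IsField I u) (ht₀ : t₀ ∈ I)
    (hw : w ∈ admissible I u) {x : Rn n} (h : u t₀ x ≤ w x) (θ : ℝ) :
    t₀ ≤ leafTime I u t₀ w x θ := by
  by_contra! hlt
  have h1 := (hu.leafParam_lt_iff ht₀ (leafLevel_mem hI hu ht₀ hw x θ)).1 hlt
  have h0 : (0 : ℝ) ≤ max 0 (min 1 θ) := le_max_left _ _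
  rw [leafLevel] at h1
  nlinarith

/-- In `calibration_eq` the integrand is nonnegative: where w ≥ u^{t₀} only leaves t ≥ t₀ are
crossed, where w ≤ u^{t₀} only leaves t ≤ t₀. -/
theorem calibC3'_leaf (hn : 1 ≤ n) {c s : ℝ} (hc : 0 < c) (hs : s ∈ Ioo (0 : ℝ) 1)
    (hI : I.OrdConnected) (hu : IsC2Field I u) (ht₀ : t₀ ∈ I) {M : ℝ}
    (hM : ∀ t ∈ I, ∀ x, |u t x| ≤ M) {Ω : Set (Rn n)} (hΩo : IsOpen Ω)
    (hΩ : Bornology.IsBounded Ω) {F : ℝ → ℝ} (hF : ContDiff ℝ 1 F)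
    (hsup : ∀ t ∈ I, t₀ ≤ t → ∀ x ∈ Ω, 0 ≤ fracLaplacian c s (u t) x - deriv F (u t x))
    (hsub : ∀ t ∈ I, t ≤ t₀ → ∀ x ∈ Ω, fracLaplacian c s (u t) x - deriv F (u t x) ≤ 0) :
    CalibC3' Ω (admissible I u) (calibration c s Ω I u t₀ F) (u t₀) := by
  intro w hw hD
  rw [calibration_eq hn hc hs hI hu ht₀ hw hM hΩo hΩ hD hF]
  refine le_add_of_nonneg_right (integral_nonneg_of_ae ?_)
  filter_upwards [ae_prod_unitMeasure_mem hΩo] with q hq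
  have ht := leafTime_mem hI hu.toIsField ht₀ hw q.1 q.2
  rcases le_total (u t₀ q.1) (w q.1) with h | h
  · exact mul_nonneg (sub_nonneg.2 h)
      (hsup _ ht (le_leafTime_of_le hI hu.toIsField ht₀ hw h q.2) _ hq)
  · exact mul_nonneg_of_nonpos_of_nonpos (sub_nonpos.2 h)
      (hsub _ ht (leafTime_le_of_le hI hu.toIsField ht₀ hw h q.2) _ hq)

theorem calibC3_leaf (hn : 1 ≤ n) {c s : ℝ} (hc : 0 < c) (hs : s ∈ Ioo (0 : ℝ) 1)
    (hI : I.OrdConnected) (hu : IsC2Field I u) (ht₀ : t₀ ∈ I) {M : ℝ}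
    (hM : ∀ t ∈ I, ∀ x, |u t x| ≤ M) {Ω : Set (Rn n)} (hΩo : IsOpen Ω)
    (hΩ : Bornology.IsBounded Ω) {F : ℝ → ℝ} (hF : ContDiff ℝ 1 F)
    (hsol : ∀ t ∈ I, ∀ x ∈ Ω, fracLaplacian c s (u t) x - deriv F (u t x) = 0) :
    CalibC3 Ω (admissible I u) (calibration c s Ω I u t₀ F) (u t₀) := by
  have key : ∀ w ∈ admissible I u, SameDirichlet Ω w (u t₀) →
      calibration c s Ω I u t₀ F w = calibration c s Ω I u t₀ F (u t₀) := by
    intro w hw hD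
    rw [calibration_eq hn hc hs hI hu ht₀ hw hM hΩo hΩ hD hF, add_eq_left]
    refine integral_eq_zero_of_ae ?_
    filter_upwards [ae_prod_unitMeasure_mem hΩo] with q hq
    rw [hsol _ (leafTime_mem hI hu.toIsField ht₀ hw q.1 q.2) _ hq, mul_zero, Pi.zero_apply]
  intro w hw w' hw' hD hD'
  rw [key w hw hD, key w' hw' hD']

theorem isMinimizer_of_calib {Ω : Set (Rn n)} {A : Set (Rn n → ℝ)} {C : (Rn n → ℝ) → ℝ}
    {E : (Rn n → ℝ) → EReal} {v : Rn n → ℝ} (hv : v ∈ A) (h1 : CalibC1 C E v)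
    (h2 : CalibC2 Ω A C E v) (h3 : CalibC3' Ω A C v) : IsMinimizer Ω A E v := by
  refine ⟨hv, fun w hw hD => ?_⟩
  rw [← h1]
  exact (EReal.coe_le_coe_iff.2 (h3 w hw hD)).trans (h2 w hw hD)

end

end FracCalib

theorem theorem1p2 (n : ℕ) (hn : 1 ≤ n) (c s : ℝ) (hc : 0 < c) (hs : s ∈ Ioo (0 : ℝ) 1)
    (I : Set ℝ) (hI : I.OrdConnected)
    (Ω : Set (Rn n)) (hΩo : IsOpen Ω) (hΩc : IsConnected Ω) (hΩb : Bornology.IsBounded Ω)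
    (u : ℝ → Rn n → ℝ) (hu : IsC2Field I u)
    (M : ℝ) (hM : ∀ x, ∀ t ∈ I, |u t x| + |derivWithin (fun τ => u τ x) I t| ≤ M)
    (t₀ : ℝ) (ht₀ : t₀ ∈ I) (F : ℝ → ℝ) (hF : ContDiff ℝ 1 F) :
    -- the fractional Laplacian of every leaf exists
    (∀ t ∈ I, ∀ x, Tendsto (fun ε => fracLaplacianTrunc c s ε (u t) x) (𝓝[>] 0)
      (𝓝 (fracLaplacian c s (u t) x))) ∧
    -- the functional is well defined on admissible functions with the exterior datum of the leaf
    (∀ w ∈ admissible I u, SameDirichlet Ω w (u t₀) → WellDefinedAt c s Ω I u t₀ F w) ∧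
    -- (a)
    (u t₀ ∈ admissible I u ∧
      CalibC1 (calibration c s Ω I u t₀ F) (energy c s Ω F) (u t₀) ∧
      CalibC2 Ω (admissible I u) (calibration c s Ω I u t₀ F) (energy c s Ω F) (u t₀)) ∧
    -- (b)
    ((∀ t ∈ I, t₀ ≤ t → ∀ x ∈ Ω, 0 ≤ fracLaplacian c s (u t) x - deriv F (u t x)) →
      (∀ t ∈ I, t ≤ t₀ → ∀ x ∈ Ω, fracLaplacian c s (u t) x - deriv F (u t x) ≤ 0) →
      CalibC3' Ω (admissible I u) (calibration c s Ω I u t₀ F) (u t₀) ∧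
      IsMinimizer Ω (admissible I u) (energy c s Ω F) (u t₀)) ∧
    -- (c)
    ((∀ t ∈ I, ∀ x ∈ Ω, fracLaplacian c s (u t) x - deriv F (u t x) = 0) →
      CalibC3 Ω (admissible I u) (calibration c s Ω I u t₀ F) (u t₀) ∧
      IsCalibration Ω (admissible I u) (calibration c s Ω I u t₀ F) (energy c s Ω F) (u t₀) ∧
      ∀ t ∈ I, IsMinimizer Ω (admissible I u) (energy c s Ω F) (u t)) := by
  have hb : ∀ t ∈ I, ∀ x, |u t x| ≤ M := fun t ht x =>
    (le_add_of_nonneg_right (abs_nonneg _)).trans (hM x t ht)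
  have hmem : ∀ t ∈ I, u t ∈ admissible I u := fun t ht => leaf_mem_admissible hu.toIsField hb ht
  have h1 : ∀ t ∈ I, CalibC1 (calibration c s Ω I u t F) (energy c s Ω F) (u t) :=
    fun t ht => calibC1_leaf hn hc hs hu ht hb hΩo hΩb F
  have h2 : ∀ t ∈ I, CalibC2 Ω (admissible I u) (calibration c s Ω I u t F) (energy c s Ω F)
      (u t) := fun t ht => calibC2_leaf hn hc hs hI hu ht hb hΩo hΩb F
  refine ⟨fun t ht x => hu.tendsto_fracLaplacianTrunc hn c hs hI hb ht x,
    fun w hw hD => wellDefinedAt hn hc hs hI hu ht₀ hw hb hΩo hΩb hD hF.continuous,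
    ⟨hmem t₀ ht₀, h1 t₀ ht₀, h2 t₀ ht₀⟩, fun hsup hsub => ?_, fun hsol => ?_⟩
  · have h3 := calibC3'_leaf hn hc hs hI hu ht₀ hb hΩo hΩb hF hsup hsub
    exact ⟨h3, isMinimizer_of_calib (hmem t₀ ht₀) (h1 t₀ ht₀) (h2 t₀ ht₀) h3⟩
  · have h3 := calibC3_leaf hn hc hs hI hu ht₀ hb hΩo hΩb hF hsol
    -- For another leaf the functional is rebuilt with that leaf as base; the equation supplies both
    -- one-sided conditions there.
    exact ⟨h3, ⟨hmem t₀ ht₀, h1 t₀ ht₀, h2 t₀ ht₀, h3⟩, fun t ht =>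
      isMinimizer_of_calib (hmem t ht) (h1 t ht) (h2 t ht)
        (calibC3'_leaf hn hc hs hI hu ht hb hΩo hΩb hF (fun r hr _ x hx => (hsol r hr x hx).ge)
          fun r hr _ x hx => (hsol r hr x hx).le)⟩
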